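/- A biquiver $G$ is a finite directed graph with vertices $1,\dots,t$ ($t\ge 1$; loops and multiple arrows are allowed), each of whose arrows is either full or dashed. A representation $\mathcal A$ of $G$ assigns to each vertex $v$ a finite-dimensional complex vector space $\mathcal A_v$, to each full arrow $\alpha$ from $u$ to $v$ a linear mapping $\mathcal A_\alpha:\mathcal A_u\to\mathcal A_v$, and to each dashed arrow $\alpha$ from $u$ to $v$ a semilinear mapping $\mathcal A_\alpha:\mathcal A_u\to\mathcal A_v$ (an additive mapping with $\mathcal A_\alpha(cx)=\bar c\,\mathcal A_\alpha x$ for $c\in\mathbb C$). Its dimension is the vector $(\dim\mathcal A_1,\dots,\dim\mathcal A_t)$. An isomorphism $\mathcal A\to\mathcal B$ is a family of linear bijections $\mathcal F_v:\mathcal A_v\to\mathcal B_v$ such that $\mathcal B_\alpha\mathcal F_u=\mathcal F_v\mathcal A_\alpha$ for every arrow $\alpha$ from $u$ to $v$. The direct sum of two representations is formed by the spaces $\mathcal A_v\oplus\mathcal B_v$ and the mappings $\mathcal A_\alpha\oplus\mathcal B_\alpha$; a representation of nonzero dimension is indecomposable if it is not isomorphic to a direct sum of two representations of nonzero dimensions.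 $G$ is representation-finite if it has only finitely many indecomposable representations up to isomorphism. The Tits form of $G$ is the integral quadratic form $$q_G(x_1,\dots,x_t)=x_1^2+\dots+x_t^2-\sum x_ux_v,$$ where the sum is over all (full and dashed) arrows of $G$, $u$ and $v$ being the start and the end of the arrow. Theorem. Let $G$ be a connected biquiver with vertices $1,\dots,t$. (a) $G$ is representation-finite if and only if $G$ can be obtained from one of the Dynkin diagrams $A_n$ ($n\ge1$), $D_n$ ($n\ge 4$), $E_6$, $E_7$, $E_8$ by replacing each edge with a full or dashed arrow (of either direction), if and only if the Tits form $q_G$ is positive definite. (b) Let $G$ be representation-finite and let $z=(z_1,\dots,z_t)$ be an integer vector with nonnegative components. There exists an indecomposable representation of $G$ of dimension $z$ if and only if $q_G(z)=1$; this representation is determined by $z$ uniquely up to isomorphism. -/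

import Mathlib

/-- A biquiver with vertex set `V` and arrow set `E`: a directed graph (loops and multiple arrows
are allowed) each of whose arrows is either full (`dashed a = false`) or dashed
(`dashed a = true`). -/
structure Biquiver (V : Type*) (E : Type*) where
  /-- the vertex at which an arrow starts -/
  src : E → V
  /-- the vertex at which an arrow ends -/
  tgt : E → V
  /-- whether the arrow is dashed -/
  dashed : E → Bool

namespace Biquiver

universe u v

variable {V : Type u} {E : Type v}

/-- The underlying graph of `G`, with orientations, loops and multiplicities forgotten. -/
def toSimpleGraph (G : Biquiver V E) : SimpleGraph V :=
  SimpleGraph.fromRel fun x y => ∃ a, G.src a = x ∧ G.tgt a = y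

/-- A biquiver is connected if it is nonempty and any two of its vertices are joined by a path of
arrows, regardless of their directions. -/
def Connected (G : Biquiver V E) : Prop :=
  G.toSimpleGraph.Connected

/-- The ring homomorphism over which the mapping attached to the arrow `a` is semilinear: the
identity of `ℂ` if `a` is full, the complex conjugation if `a` is dashed. -/
noncomputable def twist (G : Biquiver V E) (a : E) : ℂ →+* ℂ :=
  if G.dashed a then starRingEnd ℂ else RingHom.id ℂ

/-- A (finite-dimensional) representation of a biquiver: a complex vector space for each vertex,
a linear mapping for each full arrow and a semilinear mapping for each dashed arrow. -/
structure Representation (G : Biquiver V E) where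
  /-- the vector space at a vertex -/
  space : V → Type
  [addCommGroup : ∀ x, AddCommGroup (space x)]
  [module : ∀ x, Module ℂ (space x)]
  [finiteDimensional : ∀ x, FiniteDimensional ℂ (space x)]
  /-- the linear or semilinear mapping of an arrow -/
  map : ∀ a, space (G.src a) →ₛₗ[G.twist a] space (G.tgt a)

attribute [instance] Representation.addCommGroup Representation.module
  Representation.finiteDimensional

namespace Representation

variable {G : Biquiver V E}

/-- The dimension of a representation, a vector indexed by the vertices. -/
noncomputable def dim (A : G.Representation) : V → ℕ :=
  fun x => Module.finrank ℂ (A.space x)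

/-- A morphism of representations: a family of linear mappings that commutes with the mappings of
all arrows. -/
structure Hom (A B : G.Representation) where
  /-- the linear mapping at a vertex -/
  app : ∀ x, A.space x →ₗ[ℂ] B.space x
  comm : ∀ a (w : A.space (G.src a)),
    B.map a (app (G.src a) w) = app (G.tgt a) (A.map a w)

/-- Two representations are isomorphic if there is a morphism between them that is bijective at
each vertex. -/
def Isomorphic (A B : G.Representation) : Prop :=
  ∃ F : Hom A B, ∀ x, Function.Bijective (F.app x)

/-- The direct sum of two representations. -/
noncomputable def directSum (A B : G.Representation) : G.Representation where
  space x := A.space x × B.space x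
  map a :=
    { toFun := fun w => (A.map a w.1, B.map a w.2)
      map_add' := fun w w' => by simp
      map_smul' := fun c w => by
        simp only [Prod.smul_fst, Prod.smul_snd, LinearMap.map_smulₛₗ, Prod.smul_mk] }

/-- A representation of nonzero dimension is indecomposable if it is not isomorphic to a direct
sum of representations of nonzero dimensions. -/
def Indecomposable (A : G.Representation) : Prop :=
  A.dim ≠ 0 ∧
    ¬ ∃ B C : G.Representation, B.dim ≠ 0 ∧ C.dim ≠ 0 ∧ A.Isomorphic (B.directSum C)

end Representation

/-- A biquiver is representation-finite if it has only finitely many indecomposable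
representations up to isomorphism. -/
def RepresentationFinite (G : Biquiver V E) : Prop :=
  ∃ S : Set G.Representation, S.Finite ∧
    ∀ A : G.Representation, A.Indecomposable → ∃ B ∈ S, A.Isomorphic B

/-- The Tits form of a biquiver, an integral quadratic form. -/
def titsForm [Fintype V] [Fintype E] (G : Biquiver V E) : QuadraticForm ℤ (V → ℤ) :=
  ∑ x, QuadraticMap.proj x x - ∑ a, QuadraticMap.proj (G.src a) (G.tgt a)

theorem titsForm_apply [Fintype V] [Fintype E] (G : Biquiver V E) (z : V → ℤ) :
    G.titsForm z = ∑ x, z x ^ 2 - ∑ a, z (G.src a) * z (G.tgt a) := by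
  simp [titsForm, sq]

/-- `G` is obtained from the graph `D` by replacing each edge with a full or dashed arrow (of
either direction): up to renaming the vertices, the arrows of `G` correspond one-to-one to the
edges of `D`, each arrow joining the endpoints of its edge. -/
def IsObtainedFrom (G : Biquiver V E) {W : Type*} (D : SimpleGraph W) : Prop :=
  ∃ (f : V ≃ W) (g : E ≃ D.edgeSet), ∀ a, (g a : Sym2 W) = s(f (G.src a), f (G.tgt a))

/-- The graph on `0, …, n - 1` consisting of the path `0 — 1 — ⋯ — (n - 2)` and an edge from
the last vertex `n - 1` to the vertex `k`. -/
def branchGraph (n k : ℕ) : SimpleGraph (Fin n) :=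
  SimpleGraph.fromRel fun i j =>
    (i.val + 1 = j.val ∧ j.val + 1 < n) ∨ (i.val = k ∧ j.val + 1 = n)

/-- The Dynkin diagram `A_n`, meant for `1 ≤ n`. -/
def dynkinA (n : ℕ) : SimpleGraph (Fin n) :=
  SimpleGraph.pathGraph n

/-- The Dynkin diagram `D_n`, meant for `4 ≤ n`. -/
def dynkinD (n : ℕ) : SimpleGraph (Fin n) :=
  branchGraph n (n - 3)

/-- The Dynkin diagram `E_n`, meant for `n = 6, 7, 8`. -/
def dynkinE (n : ℕ) : SimpleGraph (Fin n) :=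
  branchGraph n 2

/-- `G` is obtained from one of the Dynkin diagrams `A_n`, `D_n`, `E_6`, `E_7`, `E_8` by replacing
each edge with a full or dashed arrow. -/
def IsDynkin (G : Biquiver V E) : Prop :=
  (∃ n, 1 ≤ n ∧ G.IsObtainedFrom (dynkinA n)) ∨
  (∃ n, 4 ≤ n ∧ G.IsObtainedFrom (dynkinD n)) ∨
  G.IsObtainedFrom (dynkinE 6) ∨
  G.IsObtainedFrom (dynkinE 7) ∨
  G.IsObtainedFrom (dynkinE 8)

end Biquiver

/-!
The semilinear mappings between two spaces form a real vector space. A pair of representations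
therefore has a real two-term complex, from the families of linear mappings at the vertices to the
families of semilinear mappings along the arrows; its kernel consists of the morphisms, its cokernel
of the extensions, and its index is twice the Euler form, whose diagonal is the Tits form `q`.

If `q` is positive definite, the biquiver is a forest, and conjugating the scalars at suitable
vertices makes all arrows full, so that `ℂ` acts on every representation by endomorphisms. Hence
`q = 1` on the bricks, and bricks have no self-extensions. By a lemma of Ringel, an indecomposable
that is not a brick is larger than some indecomposable with self-extensions; by induction, all
indecomposables are bricks. A representation of dimension `z` with the smallest endomorphism algebra
has no extensions between complementary direct summands, so `q` is superadditive on its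
decompositions, and `q z = 1` leaves none. Between two bricks of dimension `z` there is a nonzero
morphism, and it is bijective, as otherwise its kernel and its image would split the value `1` of
the Euler form. Since `q` has finitely many roots, there are finitely many indecomposables.

Conversely, a brick with self-extensions starts a tower of indecomposables of unbounded dimension.
If there are finitely many indecomposables, Ringel's lemma now shows that none has self-extensions,
so `q` is positive on their dimensions, and by superadditivity on all dimensions.

The forms of the Dynkin diagrams are positive definite by completing squares along the arms of
lengths `a`, `b`, `c`, because `1 / a + 1 / b + 1 / c > 1`. Conversely, if `q` is positive definite,
at most one vertex lies outside a longest path, and its position leaves only the Dynkin diagrams: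
all other cases contain an extended Dynkin diagram, whose radical vector contradicts positivity.
-/

/-! ### Semilinear mappings -/

section Semilinear

variable {R S M N : Type*} [Semiring R] [Semiring S] {σ : R →+* S}
  [AddCommMonoid M] [AddCommMonoid N] [Module R M] [Module S N]

/-- Evaluation on a basis, as a linear equivalence between semilinear mappings and families of
vectors. The scalars `T` of the equivalence only have to commute with those of the codomain. -/
noncomputable def semilinearEquivOfBasis (T : Type*) [Semiring T] [Module T N] [SMulCommClass S T N]
    {ι : Type*} [Fintype ι] (b : Module.Basis ι R M) : (M →ₛₗ[σ] N) ≃ₗ[T] (ι → N) where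
  toFun f i := f (b i)
  map_add' _ _ := rfl
  map_smul' _ _ := rfl
  invFun y :=
    { toFun := fun w => ∑ i, σ (b.repr w i) • y i
      map_add' := fun w w' => by simp [add_smul, Finset.sum_add_distrib]
      map_smul' := fun c w => by simp [mul_smul, Finset.smul_sum] }
  left_inv f := by
    ext w
    conv_rhs => rw [← b.sum_repr w, map_sum]
    exact Finset.sum_congr rfl fun i _ => (f.map_smulₛₗ _ _).symm
  right_inv y := by
    classical
    ext i
    simp [Finsupp.single_apply, apply_ite σ]

end Semilinear

section ComplexSemilinear

variable {M N : Type*} [AddCommGroup M] [AddCommGroup N] [Module ℂ M] [Module ℂ N]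
  [FiniteDimensional ℂ M] [FiniteDimensional ℂ N] (σ : ℂ →+* ℂ)

instance finite_real_semilinear : Module.Finite ℝ (M →ₛₗ[σ] N) :=
  have : Module.Finite ℝ N := Module.Finite.trans ℂ N
  Module.Finite.equiv (semilinearEquivOfBasis ℝ (Module.finBasis ℂ M)).symm

theorem finrank_real_semilinear :
    Module.finrank ℝ (M →ₛₗ[σ] N) = 2 * (Module.finrank ℂ M * Module.finrank ℂ N) := by
  have : Module.Finite ℝ N := Module.Finite.trans ℂ N
  rw [(semilinearEquivOfBasis ℝ (Module.finBasis ℂ M)).finrank_eq, Module.finrank_pi_fintype]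
  simp only [finrank_real_of_complex, Finset.sum_const, Finset.card_univ, Fintype.card_fin,
    smul_eq_mul]
  ring

end ComplexSemilinear

theorem exists_semilinear_comp_eq {K K' M N L : Type*} [DivisionRing K] [Ring K']
    {σ : K →+* K'} [AddCommGroup M] [AddCommGroup N] [AddCommGroup L] [Module K M] [Module K N]
    [Module K' L] (g : M →ₗ[K] N) (h : M →ₛₗ[σ] L) (hgh : LinearMap.ker g ≤ LinearMap.ker h) :
    ∃ k : N →ₛₗ[σ] L, ∀ w, k (g w) = h w := by
  obtain ⟨p, hp⟩ := (LinearMap.range g).subtype.exists_leftInverse_of_injective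
    (LinearMap.range g).ker_subtype
  refine ⟨(((LinearMap.ker g).liftQ h hgh).comp
    (g.quotKerEquivRange.symm : LinearMap.range g →ₗ[K] _)).comp p, fun w => ?_⟩
  have hpw : p (g w) = ⟨g w, w, rfl⟩ := LinearMap.congr_fun hp ⟨g w, w, rfl⟩
  rw [LinearMap.comp_apply, hpw]
  exact congrArg ((LinearMap.ker g).liftQ h hgh) (g.quotKerEquivRange_symm_apply_image w _)

theorem finrank_le_of_ker_le_range {K U W T : Type*} [DivisionRing K] [AddCommGroup U]
    [AddCommGroup W] [AddCommGroup T] [Module K U] [Module K W] [Module K T] [Module.Finite K U]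
    [Module.Finite K W] (i : U →ₗ[K] W) (p : W →ₗ[K] T)
    (h : LinearMap.ker p ≤ LinearMap.range i) :
    Module.finrank K W ≤ Module.finrank K U + Module.finrank K (LinearMap.range p) := by
  have hp := LinearMap.finrank_range_add_finrank_ker p
  have hle := Submodule.finrank_mono h
  have hi := LinearMap.finrank_range_le i
  lia

namespace Biquiver

variable {V : Type*} {E : Type*} {G : Biquiver V E}

/-! ### The Euler form and the complex of a pair of representations -/

theorem twist_ofReal (G : Biquiver V E) (a : E) (r : ℝ) : G.twist a (r : ℂ) = r := by
  unfold twist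
  split_ifs <;> simp

theorem map_real_smul {M N : Type*} [AddCommGroup M] [AddCommGroup N] [Module ℂ M] [Module ℂ N]
    {a : E} (f : M →ₛₗ[G.twist a] N) (r : ℝ) (w : M) : f (r • w) = r • f w := by
  rw [← Complex.coe_smul, LinearMap.map_smulₛₗ, twist_ofReal, Complex.coe_smul]

section EulerForm

variable [Fintype V] [Fintype E]

/-- The Euler form of a biquiver, the bilinear form whose diagonal is the Tits form. -/
def eulerForm (G : Biquiver V E) : LinearMap.BilinForm ℤ (V → ℤ) :=
  LinearMap.mk₂ ℤ (fun y z => ∑ x, y x * z x - ∑ a, y (G.src a) * z (G.tgt a))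
    (fun _ _ _ => by simp only [Pi.add_apply, add_mul, Finset.sum_add_distrib]; ring)
    (fun _ _ _ => by simp only [Pi.smul_apply, smul_eq_mul, mul_assoc, mul_sub, Finset.mul_sum])
    (fun _ _ _ => by simp only [Pi.add_apply, mul_add, Finset.sum_add_distrib]; ring)
    (fun _ _ _ => by
      simp only [Pi.smul_apply, smul_eq_mul, mul_left_comm _ (_ : ℤ), mul_sub, Finset.mul_sum])

theorem eulerForm_apply (y z : V → ℤ) :
    G.eulerForm y z = ∑ x, y x * z x - ∑ a, y (G.src a) * z (G.tgt a) := rfl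

theorem eulerForm_self (z : V → ℤ) : G.eulerForm z z = G.titsForm z := by
  simp only [eulerForm_apply, titsForm_apply, sq]

end EulerForm

namespace Representation

variable {A B C X Y Z : G.Representation}

/-- The dimension of a representation as an integer vector, an argument of the Tits form. -/
noncomputable abbrev dimVector (A : G.Representation) : V → ℤ := fun x => A.dim x

/-- The families of linear mappings between the spaces of two representations, compatible with
the arrows or not. -/
abbrev VertexMaps (A B : G.Representation) := ∀ x, A.space x →ₗ[ℂ] B.space x

/-- The families of semilinear mappings along the arrows, of the same kinds as the arrows. -/
abbrev ArrowMaps (A B : G.Representation) :=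
  ∀ a, A.space (G.src a) →ₛₗ[G.twist a] B.space (G.tgt a)

/-- The differential of the two-term complex that computes the morphisms from `A` to `B` (its
kernel) and the extensions of `A` by `B` (its cokernel). It is only real linear, as the mappings
along the dashed arrows are only semilinear. -/
noncomputable def differential (A B : G.Representation) : VertexMaps A B →ₗ[ℝ] ArrowMaps A B where
  toFun f a := (B.map a).comp (f (G.src a)) - (f (G.tgt a)).comp (A.map a)
  map_add' f g := by
    funext a
    ext w
    simp only [Pi.add_apply, LinearMap.sub_apply, LinearMap.comp_apply, LinearMap.add_apply,
      map_add]
    abel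
  map_smul' r f := by
    funext a
    ext w
    simp [map_real_smul, smul_sub]

theorem differential_apply (f : VertexMaps A B) (a : E) (w : A.space (G.src a)) :
    differential A B f a w = B.map a (f (G.src a) w) - f (G.tgt a) (A.map a w) := rfl

/-- The real vector space of morphisms from `A` to `B`. -/
noncomputable abbrev homs (A B : G.Representation) : Submodule ℝ (VertexMaps A B) :=
  LinearMap.ker (differential A B)

theorem mem_homs {f : VertexMaps A B} :
    f ∈ homs A B ↔ ∀ a w, B.map a (f (G.src a) w) = f (G.tgt a) (A.map a w) := by
  simp only [LinearMap.mem_ker, funext_iff, LinearMap.ext_iff, differential_apply, sub_eq_zero,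
    Pi.zero_apply, LinearMap.zero_apply]

/-- The composition of families of linear mappings, vertex by vertex. -/
noncomputable def VertexMaps.comp (g : VertexMaps B C) (f : VertexMaps A B) : VertexMaps A C :=
  fun x => (g x).comp (f x)

@[simp]
theorem VertexMaps.comp_apply (g : VertexMaps B C) (f : VertexMaps A B) (x : V) (w : A.space x) :
    g.comp f x w = g x (f x w) := rfl

/-- The family of identity mappings. -/
noncomputable def VertexMaps.id (A : G.Representation) : VertexMaps A A := fun _ => LinearMap.id

theorem id_mem_homs (A : G.Representation) : VertexMaps.id A ∈ homs A A :=
  mem_homs.2 fun _ _ => rfl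

theorem comp_mem_homs {g : VertexMaps B C} {f : VertexMaps A B} (hg : g ∈ homs B C)
    (hf : f ∈ homs A B) : g.comp f ∈ homs A C := by
  rw [mem_homs] at *
  intro a w
  rw [VertexMaps.comp_apply, VertexMaps.comp_apply, hg, hf]

theorem exists_ne_zero_of_ne_zero {f : VertexMaps A B} (hf : f ≠ 0) : ∃ x w, f x w ≠ 0 := by
  by_contra! h
  exact hf (funext fun x => LinearMap.ext (h x))

theorem isomorphic_iff :
    A.Isomorphic B ↔ ∃ f ∈ homs A B, ∀ x, Function.Bijective (f x) :=
  ⟨fun ⟨F, h⟩ => ⟨F.app, mem_homs.2 F.comm, h⟩, fun ⟨f, hf, h⟩ => ⟨⟨f, mem_homs.1 hf⟩, h⟩⟩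

theorem exists_inverse_mem_homs {f : VertexMaps A B} (hf : f ∈ homs A B)
    (hbij : ∀ x, Function.Bijective (f x)) :
    ∃ g ∈ homs B A, (∀ x w, g x (f x w) = w) ∧ ∀ x w, f x (g x w) = w := by
  let e := fun x => LinearEquiv.ofBijective (f x) (hbij x)
  have hfe : ∀ x w, f x ((e x).symm w) = w := fun x w => (e x).apply_symm_apply w
  refine ⟨fun x => (e x).symm, mem_homs.2 fun a w => (hbij _).1 ?_,
    fun x w => (e x).symm_apply_apply w, hfe⟩
  simp only [LinearEquiv.coe_coe, ← mem_homs.1 hf, hfe]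

theorem isomorphic_iff_exists_inverse :
    A.Isomorphic B ↔ ∃ f ∈ homs A B, ∃ g ∈ homs B A,
      (∀ x w, g x (f x w) = w) ∧ ∀ x w, f x (g x w) = w := by
  rw [isomorphic_iff]
  refine exists_congr fun f => and_congr_right fun hf => ⟨exists_inverse_mem_homs hf, ?_⟩
  rintro ⟨g, -, hgf, hfg⟩ x
  exact ⟨Function.LeftInverse.injective (hgf x), Function.RightInverse.surjective (hfg x)⟩

theorem Isomorphic.refl (A : G.Representation) : A.Isomorphic A :=
  isomorphic_iff.2 ⟨_, id_mem_homs A, fun _ => Function.bijective_id⟩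

theorem Isomorphic.trans (hAB : A.Isomorphic B) (hBC : B.Isomorphic C) : A.Isomorphic C := by
  rw [isomorphic_iff] at *
  obtain ⟨f, hf, hbf⟩ := hAB
  obtain ⟨g, hg, hbg⟩ := hBC
  exact ⟨g.comp f, comp_mem_homs hg hf, fun x => (hbg x).comp (hbf x)⟩

theorem Isomorphic.symm (h : A.Isomorphic B) : B.Isomorphic A := by
  rw [isomorphic_iff_exists_inverse] at *
  obtain ⟨f, hf, g, hg, hgf, hfg⟩ := h
  exact ⟨g, hg, f, hf, hfg, hgf⟩

theorem Isomorphic.dim_eq (h : A.Isomorphic B) : A.dim = B.dim := by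
  obtain ⟨f, -, hbij⟩ := isomorphic_iff.1 h
  exact funext fun x => (LinearEquiv.ofBijective (f x) (hbij x)).finrank_eq

theorem dim_directSum (A B : G.Representation) : (A.directSum B).dim = A.dim + B.dim :=
  funext fun x => Module.finrank_prod (R := ℂ) (M := A.space x) (M' := B.space x)

theorem dim_eq_zero_iff (A : G.Representation) : A.dim = 0 ↔ ∀ x (w : A.space x), w = 0 := by
  simp only [funext_iff, dim, Pi.zero_apply, Module.finrank_zero_iff]
  exact forall_congr' fun x => subsingleton_iff_forall_eq 0

theorem exists_ne_zero_of_dim_ne_zero (hA : A.dim ≠ 0) : ∃ x, ∃ w : A.space x, w ≠ 0 := by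
  by_contra! h
  exact hA ((dim_eq_zero_iff A).2 h)

section EulerForm

theorem finrank_vertexMaps [Fintype V] (A B : G.Representation) :
    Module.finrank ℝ (VertexMaps A B) = 2 * ∑ x, A.dim x * B.dim x := by
  rw [Module.finrank_pi_fintype, Finset.mul_sum]
  exact Finset.sum_congr rfl fun _ _ => finrank_real_semilinear _

theorem finrank_arrowMaps [Fintype E] (A B : G.Representation) :
    Module.finrank ℝ (ArrowMaps A B) = 2 * ∑ a, A.dim (G.src a) * B.dim (G.tgt a) := by
  rw [Module.finrank_pi_fintype, Finset.mul_sum]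
  exact Finset.sum_congr rfl fun _ _ => finrank_real_semilinear _

variable [Fintype V] [Fintype E]

theorem two_mul_eulerForm_dimVector (A B : G.Representation) :
    2 * G.eulerForm A.dimVector B.dimVector = (Module.finrank ℝ (homs A B) : ℤ) -
      Module.finrank ℝ (ArrowMaps A B ⧸ LinearMap.range (differential A B)) := by
  have hV := LinearMap.finrank_range_add_finrank_ker (differential A B)
  have hE := Submodule.finrank_quotient_add_finrank (LinearMap.range (differential A B))
  rw [finrank_vertexMaps] at hV
  rw [finrank_arrowMaps] at hE
  rw [eulerForm_apply]
  zify at hV hE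
  linarith

theorem two_mul_eulerForm_le_finrank_homs (A B : G.Representation) :
    2 * G.eulerForm A.dimVector B.dimVector ≤ Module.finrank ℝ (homs A B) := by
  rw [two_mul_eulerForm_dimVector]
  lia

theorem differential_surjective_iff (A B : G.Representation) :
    Function.Surjective (differential A B) ↔
      2 * G.eulerForm A.dimVector B.dimVector = Module.finrank ℝ (homs A B) := by
  rw [two_mul_eulerForm_dimVector, sub_eq_self, Nat.cast_eq_zero, Module.finrank_zero_iff,
    Submodule.Quotient.subsingleton_iff, LinearMap.range_eq_top]

theorem titsForm_dimVector_pos (hq : G.titsForm.PosDef) (hA : A.dim ≠ 0) :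
    0 < G.titsForm A.dimVector :=
  hq _ fun h => hA (funext fun x => Nat.cast_eq_zero.1 (congrFun h x))

end EulerForm

/-! ### Direct summands and the lemma of Ringel -/

/-- The family of kernels of a family of linear mappings. -/
abbrev VertexMaps.ker (f : VertexMaps A B) : ∀ x, Submodule ℂ (A.space x) :=
  fun x => LinearMap.ker (f x)

/-- The family of ranges of a family of linear mappings. -/
abbrev VertexMaps.range (f : VertexMaps A B) : ∀ x, Submodule ℂ (B.space x) :=
  fun x => LinearMap.range (f x)

section Subrepresentations

/-- A family of subspaces is invariant if the mappings of the arrows restrict to it. -/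
def IsInvariant (A : G.Representation) (N : ∀ x, Submodule ℂ (A.space x)) : Prop :=
  ∀ a, ∀ w ∈ N (G.src a), A.map a w ∈ N (G.tgt a)

/-- The subrepresentation on an invariant family of subspaces. -/
noncomputable def subrep (A : G.Representation) (N : ∀ x, Submodule ℂ (A.space x))
    (h : A.IsInvariant N) : G.Representation where
  space x := N x
  map a :=
    { toFun := fun w => ⟨A.map a w, h a w w.2⟩
      map_add' := fun w w' => by ext; simp
      map_smul' := fun c w => by ext; simp [LinearMap.map_smulₛₗ] }

/-- The inclusion of a subrepresentation. -/
noncomputable def subtype (A : G.Representation) {N : ∀ x, Submodule ℂ (A.space x)}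
    (h : A.IsInvariant N) : VertexMaps (A.subrep N h) A :=
  fun x => (N x).subtype

theorem subtype_mem_homs {N : ∀ x, Submodule ℂ (A.space x)} (h : A.IsInvariant N) :
    A.subtype h ∈ homs (A.subrep N h) A :=
  mem_homs.2 fun _ _ => rfl

theorem isInvariant_ker {f : VertexMaps A B} (hf : f ∈ homs A B) : A.IsInvariant f.ker := by
  intro a w hw
  rw [LinearMap.mem_ker] at *
  rw [← mem_homs.1 hf, hw, map_zero]

theorem isInvariant_range {f : VertexMaps A B} (hf : f ∈ homs A B) : B.IsInvariant f.range := by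
  rintro a _ ⟨w, rfl⟩
  exact ⟨A.map a w, (mem_homs.1 hf a w).symm⟩

variable {N N' : ∀ x, Submodule ℂ (A.space x)}

theorem isomorphic_directSum_of_isCompl (h : A.IsInvariant N) (h' : A.IsInvariant N')
    (hc : ∀ x, IsCompl (N x) (N' x)) :
    A.Isomorphic ((A.subrep N h).directSum (A.subrep N' h')) := by
  refine Isomorphic.symm (isomorphic_iff.2
    ⟨fun x => ((N x).prodEquivOfIsCompl (N' x) (hc x)).toLinearMap, mem_homs.2 fun a w => ?_,
      fun x => ((N x).prodEquivOfIsCompl (N' x) (hc x)).bijective⟩)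
  exact map_add (A.map a) (w.1.1 : A.space (G.src a)) (w.2.1 : A.space (G.src a))

theorem Indecomposable.eq_bot_or_eq_bot (hA : A.Indecomposable) (h : A.IsInvariant N)
    (h' : A.IsInvariant N') (hc : ∀ x, IsCompl (N x) (N' x)) : N = ⊥ ∨ N' = ⊥ := by
  have eq_bot_of_dim_eq_zero : ∀ {L} (hL : A.IsInvariant L), (A.subrep L hL).dim = 0 → L = ⊥ :=
    fun hL h0 => funext fun x => (Submodule.eq_bot_iff _).2 fun w hw =>
      congrArg Subtype.val ((dim_eq_zero_iff _).1 h0 x ⟨w, hw⟩)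
  by_contra! hcon
  exact hA.2 ⟨_, _, mt (eq_bot_of_dim_eq_zero h) hcon.1, mt (eq_bot_of_dim_eq_zero h') hcon.2,
    isomorphic_directSum_of_isCompl h h' hc⟩

end Subrepresentations

section DirectSums

/-- The first inclusion of a direct sum. -/
noncomputable def inl (A B : G.Representation) : VertexMaps A (A.directSum B) :=
  fun x => LinearMap.inl ℂ (A.space x) (B.space x)

/-- The second inclusion of a direct sum. -/
noncomputable def inr (A B : G.Representation) : VertexMaps B (A.directSum B) :=
  fun x => LinearMap.inr ℂ (A.space x) (B.space x)

/-- The first projection of a direct sum. -/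
noncomputable def fst (A B : G.Representation) : VertexMaps (A.directSum B) A :=
  fun x => LinearMap.fst ℂ (A.space x) (B.space x)

/-- The second projection of a direct sum. -/
noncomputable def snd (A B : G.Representation) : VertexMaps (A.directSum B) B :=
  fun x => LinearMap.snd ℂ (A.space x) (B.space x)

theorem inl_mem_homs (A B : G.Representation) : inl A B ∈ homs A (A.directSum B) :=
  mem_homs.2 fun a _ => Prod.ext rfl (map_zero (B.map a))

theorem inr_mem_homs (A B : G.Representation) : inr A B ∈ homs B (A.directSum B) :=
  mem_homs.2 fun a _ => Prod.ext (map_zero (A.map a)) rfl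

theorem fst_mem_homs (A B : G.Representation) : fst A B ∈ homs (A.directSum B) A :=
  mem_homs.2 fun _ _ => rfl

theorem snd_mem_homs (A B : G.Representation) : snd A B ∈ homs (A.directSum B) B :=
  mem_homs.2 fun _ _ => rfl

end DirectSums

section Retractions

/-- The morphism `p` is a retraction onto `Y` of the inclusion `i` of `Y` in `X`, which makes `Y`
a direct summand of `X`. -/
structure IsRetraction (i : VertexMaps Y X) (p : VertexMaps X Y) : Prop where
  incl_mem : i ∈ homs Y X
  proj_mem : p ∈ homs X Y
  leftInverse : ∀ x w, p x (i x w) = w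

theorem isRetraction_inl_fst (A B : G.Representation) : IsRetraction (inl A B) (fst A B) :=
  ⟨inl_mem_homs A B, fst_mem_homs A B, fun _ _ => rfl⟩

theorem isRetraction_inr_snd (A B : G.Representation) : IsRetraction (inr A B) (snd A B) :=
  ⟨inr_mem_homs A B, snd_mem_homs A B, fun _ _ => rfl⟩

theorem IsRetraction.trans {i : VertexMaps Z Y} {p : VertexMaps Y Z} {j : VertexMaps Y X}
    {q : VertexMaps X Y} (hip : IsRetraction i p) (hjq : IsRetraction j q) :
    IsRetraction (j.comp i) (p.comp q) where
  incl_mem := comp_mem_homs hjq.incl_mem hip.incl_mem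
  proj_mem := comp_mem_homs hip.proj_mem hjq.proj_mem
  leftInverse x w := by
    simp only [VertexMaps.comp_apply, hjq.leftInverse, hip.leftInverse]

theorem IsRetraction.injective {i : VertexMaps Y X} {p : VertexMaps X Y} (h : IsRetraction i p)
    (x : V) : Function.Injective (i x) :=
  Function.LeftInverse.injective (h.leftInverse x)

theorem IsRetraction.bijective_of_indecomposable {i : VertexMaps Y X} {p : VertexMaps X Y}
    (h : IsRetraction i p) (hX : X.Indecomposable) (hY : Y.dim ≠ 0) (x : V) :
    Function.Bijective (i x) := by
  have hc : ∀ x, IsCompl (i.range x) (p.ker x) := by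
    intro x
    have hproj := LinearMap.isCompl_of_proj (p := i.range x) (f := (i x).rangeRestrict ∘ₗ p x)
      (by rintro ⟨_, w, rfl⟩; exact Subtype.ext (congrArg (i x) (h.leftInverse x w)))
    rwa [LinearMap.ker_comp_of_ker_eq_bot _
      ((i x).ker_rangeRestrict.trans (LinearMap.ker_eq_bot.2 (h.injective x)))] at hproj
  rcases hX.eq_bot_or_eq_bot (isInvariant_range h.incl_mem) (isInvariant_ker h.proj_mem) hc
    with hi | hp
  · refine absurd ((dim_eq_zero_iff Y).2 fun x w => ?_) hY
    rw [← h.leftInverse x w, LinearMap.range_eq_bot.1 (congrFun hi x), LinearMap.zero_apply,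
      map_zero]
  · exact ⟨h.injective x, fun w =>
      ⟨p x w, LinearMap.ker_eq_bot.1 (congrFun hp x) (h.leftInverse x _)⟩⟩

end Retractions

section TotalDimension

variable [Fintype V]

/-- The sum of the dimensions of the spaces of a representation. -/
noncomputable def totalDim (A : G.Representation) : ℕ := ∑ x, A.dim x

theorem totalDim_directSum (A B : G.Representation) :
    (A.directSum B).totalDim = A.totalDim + B.totalDim := by
  simp [totalDim, dim_directSum, Finset.sum_add_distrib]

theorem Isomorphic.totalDim_eq (h : A.Isomorphic B) : A.totalDim = B.totalDim := by
  rw [totalDim, totalDim, h.dim_eq]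

theorem totalDim_pos (h : A.dim ≠ 0) : 0 < A.totalDim :=
  Nat.pos_of_ne_zero fun h0 => h (funext fun x => Finset.sum_eq_zero_iff.1 h0 x (Finset.mem_univ x))

theorem totalDim_lt_of_injective {f : VertexMaps A B} (hinj : ∀ x, Function.Injective (f x))
    (hf : ¬ ∀ x, Function.Bijective (f x)) : A.totalDim < B.totalDim := by
  obtain ⟨x, hx⟩ := not_forall.1 hf
  refine Finset.sum_lt_sum (fun y _ => LinearMap.finrank_le_finrank_of_injective (hinj y))
    ⟨x, Finset.mem_univ x, lt_of_not_ge fun hle => hx ⟨hinj x, ?_⟩⟩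
  exact (LinearMap.injective_iff_surjective_of_finrank_eq_finrank
    (hle.antisymm' (LinearMap.finrank_le_finrank_of_injective (hinj x)))).1 (hinj x)

end TotalDimension

theorem exists_indecomposable_isRetraction [Finite V] (K : G.Representation) {x : V} {w : K.space x}
    (hw : w ≠ 0) : ∃ (Y : G.Representation) (i : VertexMaps Y K) (p : VertexMaps K Y),
      Y.Indecomposable ∧ IsRetraction i p ∧ p x w ≠ 0 := by
  have := Fintype.ofFinite V
  induction hn : K.totalDim using Nat.strong_induction_on generalizing K with
  | _ n ih =>
    have hK0 : K.dim ≠ 0 := fun h => hw ((dim_eq_zero_iff K).1 h x w)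
    by_cases hK : K.Indecomposable
    · exact ⟨K, .id K, .id K, hK, ⟨id_mem_homs K, id_mem_homs K, fun _ _ => rfl⟩, hw⟩
    obtain ⟨B, C, hB, hC, hKBC⟩ := not_not.1 fun h => hK ⟨hK0, h⟩
    have hdim := hKBC.totalDim_eq
    rw [totalDim_directSum] at hdim
    have hBpos := totalDim_pos hB
    have hCpos := totalDim_pos hC
    obtain ⟨F, hF, F', hF', hF'F, hFF'⟩ := isomorphic_iff_exists_inverse.1 hKBC
    have hiso : IsRetraction F' F := ⟨hF', hF, hFF'⟩
    by_cases hfst : fst B C x (F x w) = 0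
    · have hsnd : snd B C x (F x w) ≠ 0 := fun hsnd =>
        hw (by rw [← hF'F x w, show F x w = 0 from Prod.ext hfst hsnd, map_zero])
      obtain ⟨Y, i, p, hY, hip, hp⟩ := ih _ (by lia) C hsnd rfl
      exact ⟨Y, _, _, hY, hip.trans ((isRetraction_inr_snd B C).trans hiso), hp⟩
    · obtain ⟨Y, i, p, hY, hip, hp⟩ := ih _ (by lia) B hfst rfl
      exact ⟨Y, _, _, hY, hip.trans ((isRetraction_inl_fst B C).trans hiso), hp⟩

theorem Indecomposable.ker_eq_bot_of_disjoint (hX : X.Indecomposable) {f : VertexMaps X X}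
    (hf : f ∈ homs X X) (hf0 : f ≠ 0) (hdisj : ∀ x, Disjoint (f.ker x) (f.range x)) :
    f.ker = ⊥ := by
  have hc : ∀ x, IsCompl (f.ker x) (f.range x) := fun x =>
    (Submodule.isCompl_iff_disjoint _ _ (by
      rw [add_comm, LinearMap.finrank_range_add_finrank_ker])).2 (hdisj x)
  refine (hX.eq_bot_or_eq_bot (isInvariant_ker hf) (isInvariant_range hf) hc).resolve_right
    fun h => hf0 (funext fun x => LinearMap.range_eq_bot.1 (congrFun h x))

theorem Indecomposable.exists_maximal_ker [Finite V] (hX : X.Indecomposable)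
    {f : VertexMaps X X} (hf : f ∈ homs X X) (hf0 : f ≠ 0) (hker : f.ker ≠ ⊥) :
    ∃ g ∈ homs X X, g ≠ 0 ∧ (∀ x w, g x (g x w) = 0) ∧
      ∀ h ∈ homs X X, h ≠ 0 → g.ker ≤ h.ker → h.ker ≤ g.ker := by
  have : WellFoundedGT (∀ x, Submodule ℂ (X.space x)) :=
    Pi.wellFoundedLT (α := fun x => (Submodule ℂ (X.space x))ᵒᵈ)
  obtain ⟨g, ⟨hg, hg0, hfg⟩, hmax⟩ := exists_maximalFor_of_wellFoundedGT
    (fun g : VertexMaps X X => g ∈ homs X X ∧ g ≠ 0 ∧ f.ker ≤ g.ker) VertexMaps.ker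
    ⟨f, hf, hf0, le_rfl⟩
  refine ⟨g, hg, hg0, ?_, fun h hh hh0 hgh => hmax ⟨hh, hh0, hfg.trans hgh⟩ hgh⟩
  by_contra! hsq
  obtain ⟨x, w, hw⟩ := hsq
  have hle : g.ker ≤ (g.comp g).ker := fun x => LinearMap.ker_le_ker_comp _ _
  have hge : (g.comp g).ker ≤ g.ker := hmax ⟨comp_mem_homs hg hg, fun h => hw (by
    rw [← VertexMaps.comp_apply, h]; rfl), hfg.trans hle⟩ hle
  refine hker (eq_bot_iff.2 (hfg.trans_eq (hX.ker_eq_bot_of_disjoint hg hg0 fun x => ?_)))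
  rw [Submodule.disjoint_def]
  rintro _ hy ⟨y, rfl⟩
  exact hge x hy

theorem exists_extension_of_differential_surjective {N : ∀ x, Submodule ℂ (A.space x)}
    (hN : A.IsInvariant N) {κ : VertexMaps A Z} (hκ : κ ∈ homs A Z) (hker : κ.ker = N)
    (hZY : Function.Surjective (differential Z Y)) {p : VertexMaps (A.subrep N hN) Y}
    (hp : p ∈ homs (A.subrep N hN) Y) :
    ∃ r ∈ homs A Y, r.comp (A.subtype hN) = p := by
  choose q hq using fun x => LinearMap.exists_extend (p x)
  have hq' : ∀ x w (hw : w ∈ N x), q x w = p x ⟨w, hw⟩ := fun x w hw =>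
    LinearMap.congr_fun (hq x) ⟨w, hw⟩
  have hfactor : ∀ a, LinearMap.ker (κ (G.src a)) ≤ LinearMap.ker (differential A Y q a) := by
    intro a w hw
    have hwN : w ∈ N (G.src a) := hker ▸ hw
    rw [LinearMap.mem_ker, differential_apply, hq' _ _ hwN, hq' _ _ (hN a w hwN), sub_eq_zero]
    exact mem_homs.1 hp a ⟨w, hwN⟩
  choose k hk using fun a => exists_semilinear_comp_eq _ _ (hfactor a)
  obtain ⟨f, hf⟩ := hZY k
  refine ⟨q - f.comp κ, ?_, funext fun x => LinearMap.ext fun w => ?_⟩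
  · have hfκ : differential A Y (f.comp κ) = differential A Y q := by
      funext a
      ext w
      rw [← hk a w, ← hf, differential_apply, differential_apply, VertexMaps.comp_apply,
        VertexMaps.comp_apply, mem_homs.1 hκ]
    rw [LinearMap.mem_ker, map_sub, hfκ, sub_self]
  · have hκw : κ x w.1 = 0 := LinearMap.mem_ker.1 (hker ▸ w.2 : w.1 ∈ κ.ker x)
    change q x w.1 - f x (κ x w.1) = p x w
    rw [hκw, map_zero, sub_zero]
    exact hq' x w.1 w.2

theorem ker_eq_of_injective {N : ∀ x, Submodule ℂ (X.space x)}
    (hmax : ∀ h ∈ homs X X, h ≠ 0 → N ≤ h.ker → h.ker ≤ N) {κ : VertexMaps X Y}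
    (hκ : κ ∈ homs X Y) (hκ0 : κ ≠ 0) (hle : N ≤ κ.ker) {ι : VertexMaps Y X} (hι : ι ∈ homs Y X)
    (hinj : ∀ x, Function.Injective (ι x)) : κ.ker = N := by
  have hcomp : (ι.comp κ).ker = κ.ker :=
    funext fun x => LinearMap.ker_comp_of_ker_eq_bot _ (LinearMap.ker_eq_bot.2 (hinj x))
  obtain ⟨x, w, hw⟩ := exists_ne_zero_of_ne_zero hκ0
  have hne : ι.comp κ ≠ 0 := fun h =>
    hw (hinj x (by rw [map_zero]; exact LinearMap.congr_fun (congrFun h x) w))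
  exact le_antisymm (hcomp ▸ hmax _ (comp_mem_homs hι hκ) hne (hcomp ▸ hle)) hle

theorem Indecomposable.exists_smaller_differential_not_surjective [Fintype V]
    (hX : X.Indecomposable) {f : VertexMaps X X} (hf : f ∈ homs X X) (hf0 : f ≠ 0)
    (hker : f.ker ≠ ⊥) :
    ∃ Y : G.Representation, Y.Indecomposable ∧ Y.totalDim < X.totalDim ∧
      ¬ Function.Surjective (differential Y Y) := by
  obtain ⟨θ, hθ, hθ0, hsq, hmax⟩ := hX.exists_maximal_ker hf hf0 hker
  let K := X.subrep θ.ker (isInvariant_ker hθ)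
  let ι : VertexMaps K X := X.subtype (isInvariant_ker hθ)
  have hι : ι ∈ homs K X := subtype_mem_homs _
  let θ' : VertexMaps X K := fun x => (θ x).codRestrict _ (hsq x)
  have hθ' : θ' ∈ homs X K := mem_homs.2 fun a w => Subtype.ext (mem_homs.1 hθ a w)
  obtain ⟨x, w, hw⟩ := exists_ne_zero_of_ne_zero hθ0
  obtain ⟨Y, i, p, hY, hip, hpw⟩ := exists_indecomposable_isRetraction K (w := θ' x w)
    fun h => hw (congrArg Subtype.val h)
  have hinj : ∀ x, Function.Injective (ι.comp i x) := fun x =>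
    Subtype.val_injective.comp (hip.injective x)
  have hnb : ¬ ∀ x, Function.Bijective (ι.comp i x) := fun hb => hw <| by
    obtain ⟨y, hy⟩ := (hb x).2 w
    exact hy ▸ (i x y).2
  have hκ : p.comp θ' ∈ homs X Y := comp_mem_homs hip.proj_mem hθ'
  have hkerκ : (p.comp θ').ker = θ.ker :=
    ker_eq_of_injective hmax hκ (fun h => hpw (LinearMap.congr_fun (congrFun h x) w))
      (fun x w hw => by
        rw [LinearMap.mem_ker, VertexMaps.comp_apply, show θ' x w = 0 from Subtype.ext hw,
          map_zero])
      (comp_mem_homs hι hip.incl_mem) hinj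
  -- If `Y` had no self-extensions, `p` would extend to `X` and split `Y` off.
  refine ⟨Y, hY, totalDim_lt_of_injective hinj hnb, fun hsurj => hnb ?_⟩
  obtain ⟨r, hr, hrp⟩ := exists_extension_of_differential_surjective (isInvariant_ker hθ) hκ
    hkerκ hsurj hip.proj_mem
  refine IsRetraction.bijective_of_indecomposable ⟨comp_mem_homs hι hip.incl_mem, hr, ?_⟩ hX hY.1
  intro x w
  exact (LinearMap.congr_fun (congrFun hrp x) (i x w)).trans (hip.leftInverse x w)

end Representation

/-! ### Untwisting -/

section Arrows

variable [DecidableEq V]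

/-- The arrows that start in `S` and end in `T`. -/
def arrows [Fintype E] (G : Biquiver V E) (S T : Finset V) : Finset E :=
  {a | G.src a ∈ S ∧ G.tgt a ∈ T}

theorem mem_arrows [Fintype E] {S T : Finset V} {a : E} :
    a ∈ G.arrows S T ↔ G.src a ∈ S ∧ G.tgt a ∈ T := by
  simp [arrows]

/-- The indicator vector of a set of vertices. -/
def indicator (S : Finset V) : V → ℤ := fun x => if x ∈ S then 1 else 0

theorem indicator_ne_zero {S : Finset V} (h : S.Nonempty) : indicator S ≠ 0 := by
  obtain ⟨x, hx⟩ := h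
  intro h0
  simpa [indicator, hx] using congrFun h0 x

theorem indicator_insert {S : Finset V} {x : V} (h : x ∉ S) :
    indicator (insert x S) = indicator S + indicator {x} := by
  funext y
  by_cases hy : y = x
  · subst hy
    simp [indicator, h]
  · simp [indicator, hy]

variable [Fintype V] [Fintype E]

theorem eulerForm_indicator (G : Biquiver V E) (S T : Finset V) :
    G.eulerForm (indicator S) (indicator T) = ((S ∩ T).card : ℤ) - (G.arrows S T).card := by
  simp [eulerForm_apply, indicator, arrows, ← ite_and, and_comm, Finset.filter_and]

theorem titsForm_indicator (G : Biquiver V E) (S : Finset V) :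
    G.titsForm (indicator S) = (S.card : ℤ) - (G.arrows S S).card := by
  rw [← eulerForm_self, eulerForm_indicator, Finset.inter_self]

theorem titsForm_indicator_singleton_le (G : Biquiver V E) (x : V) :
    G.titsForm (indicator {x}) ≤ 1 := by
  rw [titsForm_indicator, Finset.card_singleton]
  lia

theorem card_arrows_lt_card (hq : G.titsForm.PosDef) {S : Finset V} (hS : S.Nonempty) :
    (G.arrows S S).card < S.card := by
  have hpos := hq _ (indicator_ne_zero hS)
  rw [titsForm_indicator] at hpos
  lia

theorem exists_card_arrows_le_one (hq : G.titsForm.PosDef) {S : Finset V} (hS : S.Nonempty) :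
    ∃ x ∈ S, (G.arrows {x} S).card + (G.arrows S {x}).card ≤ 1 := by
  by_contra! hcon
  have hsrc : (G.arrows S S).card = ∑ x ∈ S, (G.arrows {x} S).card := by
    rw [Finset.card_eq_sum_card_fiberwise fun a ha => (mem_arrows.1 ha).1]
    refine Finset.sum_congr rfl fun x hx => congrArg Finset.card (Finset.ext fun a => ?_)
    simp only [Finset.mem_filter, mem_arrows, Finset.mem_singleton]
    grind
  have htgt : (G.arrows S S).card = ∑ x ∈ S, (G.arrows S {x}).card := by
    rw [Finset.card_eq_sum_card_fiberwise fun a ha => (mem_arrows.1 ha).2]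
    refine Finset.sum_congr rfl fun x hx => congrArg Finset.card (Finset.ext fun a => ?_)
    simp only [Finset.mem_filter, mem_arrows, Finset.mem_singleton]
    grind
  have hsum := Finset.card_nsmul_le_sum S _ 2 hcon
  rw [Finset.sum_add_distrib, ← hsrc, ← htgt, smul_eq_mul] at hsum
  have hlt := card_arrows_lt_card hq hS
  lia

end Arrows

theorem src_ne_tgt [Fintype V] [Fintype E] (hq : G.titsForm.PosDef) (a : E) :
    G.src a ≠ G.tgt a := by
  classical
  intro h
  have hlt := card_arrows_lt_card hq (Finset.singleton_nonempty (G.src a))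
  rw [Finset.card_singleton, Nat.lt_one_iff, Finset.card_eq_zero] at hlt
  exact Finset.notMem_empty a (hlt ▸ mem_arrows.2 ⟨by simp, by simp [h]⟩)

/-- Conjugating the scalars of the spaces at the vertices with `ε x = true` makes all arrows
full. -/
def IsUntwisting (G : Biquiver V E) (ε : V → Bool) : Prop :=
  ∀ a, G.dashed a = xor (ε (G.src a)) (ε (G.tgt a))

theorem exists_isUntwisting [Fintype V] [Fintype E] (hq : G.titsForm.PosDef) :
    ∃ ε, G.IsUntwisting ε := by
  classical
  suffices h : ∀ S : Finset V, ∃ ε : V → Bool, ∀ a ∈ G.arrows S S,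
      G.dashed a = xor (ε (G.src a)) (ε (G.tgt a)) by
    obtain ⟨ε, hε⟩ := h Finset.univ
    exact ⟨ε, fun a => hε a (mem_arrows.2 ⟨Finset.mem_univ _, Finset.mem_univ _⟩)⟩
  intro S
  induction S using Finset.strongInduction with | H S ih => ?_
  rcases S.eq_empty_or_nonempty with rfl | hS
  · exact ⟨fun _ => false, fun a ha => absurd (mem_arrows.1 ha).1 (Finset.notMem_empty _)⟩
  -- A forest is untwisted leaf by leaf: only one arrow joins `x` with the rest of `S`.
  obtain ⟨x, hx, hleaf⟩ := exists_card_arrows_le_one hq hS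
  obtain ⟨ε, hε⟩ := ih _ (Finset.erase_ssubset hx)
  have hne := src_ne_tgt hq
  have hunique : ∀ a ∈ G.arrows {x} S ∪ G.arrows S {x}, ∀ b ∈ G.arrows {x} S ∪ G.arrows S {x},
      a = b := Finset.card_le_one.1 ((Finset.card_union_le _ _).trans hleaf)
  obtain ⟨c, hc⟩ : ∃ c : Bool, ∀ a ∈ G.arrows {x} S ∪ G.arrows S {x},
      G.dashed a = xor c (if G.src a = x then ε (G.tgt a) else ε (G.src a)) := by
    by_cases hb : ∃ b, b ∈ G.arrows {x} S ∪ G.arrows S {x}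
    · obtain ⟨b, hb⟩ := hb
      refine ⟨xor (G.dashed b) (if G.src b = x then ε (G.tgt b) else ε (G.src b)), fun a ha => ?_⟩
      rw [hunique a ha b hb, Bool.xor_assoc, Bool.xor_self, Bool.xor_false]
    · exact ⟨false, fun a ha => absurd ⟨a, ha⟩ hb⟩
  refine ⟨Function.update ε x c, fun a ha => ?_⟩
  have hε' := hε a
  have hc' := hc a
  have hne' := hne a
  simp only [Finset.mem_union, mem_arrows, Finset.mem_singleton, Finset.mem_erase,
    Function.update_apply] at ha hc' hε' ⊢
  grind

/-! ### Bricks -/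

/-- The identity or the complex conjugation, the automorphism that twists the scalars at a
vertex. -/
noncomputable def conjIf (b : Bool) : ℂ →+* ℂ := if b then starRingEnd ℂ else RingHom.id ℂ

@[simp]
theorem conjIf_conjIf (b : Bool) (c : ℂ) : conjIf b (conjIf b c) = c := by
  cases b <;> simp [conjIf]

@[simp]
theorem conjIf_ofReal (b : Bool) (r : ℝ) : conjIf b (r : ℂ) = r := by
  cases b <;> simp [conjIf]

theorem IsUntwisting.twist_conjIf {ε : V → Bool} (h : G.IsUntwisting ε) (a : E) (c : ℂ) :
    G.twist a (conjIf (ε (G.src a)) c) = conjIf (ε (G.tgt a)) c := by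
  unfold twist conjIf
  rw [h a]
  cases ε (G.src a) <;> cases ε (G.tgt a) <;> simp

namespace Representation

variable {A B M N X : G.Representation}

/-- A brick: a nonzero representation whose nonzero endomorphisms are bijective. -/
def IsBrick (A : G.Representation) : Prop :=
  A.dim ≠ 0 ∧ ∀ f ∈ homs A A, f ≠ 0 → ∀ x, Function.Bijective (f x)

theorem Indecomposable.isBrick_of_forall_differential_surjective [Finite V]
    (hX : X.Indecomposable)
    (h : ∀ Y : G.Representation, Y.IsBrick → Function.Surjective (differential Y Y)) :
    X.IsBrick := by
  have := Fintype.ofFinite V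
  induction hn : X.totalDim using Nat.strong_induction_on generalizing X with
  | _ n ih =>
    refine ⟨hX.1, fun f hf hf0 => ?_⟩
    by_cases hker : VertexMaps.ker f = ⊥
    · have hinj : ∀ x, Function.Injective (f x) := fun x => LinearMap.ker_eq_bot.1 (congrFun hker x)
      exact fun x => ⟨hinj x, LinearMap.injective_iff_surjective.1 (hinj x)⟩
    · obtain ⟨Y, hY, hlt, hns⟩ := hX.exists_smaller_differential_not_surjective hf hf0 hker
      exact absurd (h Y (ih _ (hn ▸ hlt) hY rfl)) hns

section ScalarEnd

variable {ε : V → Bool}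

/-- The scalar endomorphisms of a representation of an untwisted biquiver, conjugated at the
vertices `x` with `ε x = true`. -/
noncomputable def scalarEnd (h : G.IsUntwisting ε) (A : G.Representation) :
    ℂ →ₗ[ℝ] homs A A where
  toFun c := ⟨fun x => conjIf (ε x) c • LinearMap.id, mem_homs.2 fun a w => by
    simp [LinearMap.map_smulₛₗ, h.twist_conjIf]⟩
  map_add' c d := by
    ext x w
    simp [add_smul]
  map_smul' r c := by
    ext x w
    simp [mul_smul]

theorem scalarEnd_apply (h : G.IsUntwisting ε) (A : G.Representation) (c : ℂ) (x : V)
    (w : A.space x) : (scalarEnd h A c : VertexMaps A A) x w = conjIf (ε x) c • w := rfl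

theorem scalarEnd_injective (h : G.IsUntwisting ε) (hA : A.dim ≠ 0) :
    Function.Injective (scalarEnd h A) := by
  rw [injective_iff_map_eq_zero]
  intro c hc
  obtain ⟨x, w, hw⟩ := exists_ne_zero_of_dim_ne_zero hA
  have hcw : conjIf (ε x) c • w = 0 := by
    rw [← scalarEnd_apply h A, hc]
    rfl
  rw [← conjIf_conjIf (ε x) c, (smul_eq_zero.1 hcw).resolve_right hw, map_zero]

theorem IsBrick.scalarEnd_surjective (h : G.IsUntwisting ε) (hA : A.IsBrick) :
    Function.Surjective (scalarEnd h A) := by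
  rintro ⟨f, hf⟩
  obtain ⟨x, w, hw⟩ := exists_ne_zero_of_dim_ne_zero hA.1
  have : Nontrivial (A.space x) := ⟨⟨w, 0, hw⟩⟩
  obtain ⟨l, hl⟩ := Module.End.exists_eigenvalue (f x)
  obtain ⟨y, hy⟩ := hl.exists_hasEigenvector
  set s := scalarEnd h A (conjIf (ε x) l)
  have hsy : (f - (s : VertexMaps A A)) x y = 0 := by
    rw [Pi.sub_apply, LinearMap.sub_apply, scalarEnd_apply, conjIf_conjIf, hy.apply_eq_smul,
      sub_self]
  refine ⟨conjIf (ε x) l, Subtype.ext ?_⟩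
  by_contra hne
  have hinj := (hA.2 _ (Submodule.sub_mem _ hf s.2) (sub_ne_zero.2 (Ne.symm hne)) x).1
  exact hy.2 (hinj (hsy.trans (map_zero _).symm))

theorem IsBrick.finrank_homs (h : G.IsUntwisting ε) (hA : A.IsBrick) :
    Module.finrank ℝ (homs A A) = 2 := by
  rw [← (LinearEquiv.ofBijective _
    ⟨scalarEnd_injective h hA.1, hA.scalarEnd_surjective h⟩).finrank_eq,
    Complex.finrank_real_complex]

end ScalarEnd

section PosDef

variable [Fintype V] [Fintype E]

theorem IsBrick.titsForm_dimVector (hq : G.titsForm.PosDef) (hA : A.IsBrick) :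
    G.titsForm A.dimVector = 1 := by
  obtain ⟨ε, hε⟩ := exists_isUntwisting hq
  have hpos := titsForm_dimVector_pos hq hA.1
  have hle := two_mul_eulerForm_le_finrank_homs A A
  rw [eulerForm_self, hA.finrank_homs hε] at hle
  lia

theorem IsBrick.differential_surjective (hq : G.titsForm.PosDef) (hA : A.IsBrick) :
    Function.Surjective (differential A A) := by
  obtain ⟨ε, hε⟩ := exists_isUntwisting hq
  rw [differential_surjective_iff, eulerForm_self, hA.titsForm_dimVector hq, hA.finrank_homs hε]
  rfl

theorem Indecomposable.isBrick (hq : G.titsForm.PosDef) (hX : X.Indecomposable) :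
    X.IsBrick :=
  hX.isBrick_of_forall_differential_surjective fun _ hY => hY.differential_surjective hq

end PosDef

/-! ### Extensions and minimal endomorphism algebras -/

/-- Composition with a morphism on the left. -/
noncomputable def postcomp (X : G.Representation) (p : homs A B) : homs X A →ₗ[ℝ] homs X B where
  toFun f := ⟨p.1.comp f.1, comp_mem_homs p.2 f.2⟩
  map_add' f g := by
    ext x w
    simp
  map_smul' r f := by
    ext x w
    simp [LinearMap.map_smul_of_tower]

/-- Composition with a morphism on the right. -/
noncomputable def precomp (p : homs A B) (X : G.Representation) : homs B X →ₗ[ℝ] homs A X where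
  toFun f := ⟨f.1.comp p.1, comp_mem_homs f.2 p.2⟩
  map_add' f g := by
    ext x w
    simp
  map_smul' r f := by
    ext x w
    simp

theorem postcomp_apply (X : G.Representation) (p : homs A B) (f : homs X A) (x : V)
    (w : X.space x) : (postcomp X p f).1 x w = p.1 x (f.1 x w) := rfl

theorem precomp_apply (p : homs A B) (X : G.Representation) (f : homs B X) (x : V)
    (w : A.space x) : (precomp p X f).1 x w = f.1 x (p.1 x w) := rfl

/-- The extension of `B` by `A` given by a family of semilinear mappings. -/
noncomputable def extension (A B : G.Representation) (η : ArrowMaps B A) : G.Representation where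
  space x := A.space x × B.space x
  map a :=
    { toFun := fun w => (A.map a w.1 + η a w.2, B.map a w.2)
      map_add' := fun w w' => by
        simp only [Prod.fst_add, Prod.snd_add, map_add, Prod.mk_add_mk]
        congr 1
        abel
      map_smul' := fun c w => by
        simp only [Prod.smul_fst, Prod.smul_snd, LinearMap.map_smulₛₗ, Prod.smul_mk, smul_add] }

theorem dim_extension (η : ArrowMaps B A) : (A.extension B η).dim = A.dim + B.dim :=
  dim_directSum A B

/-- The inclusion of the subrepresentation of an extension. -/
noncomputable def extensionInl (η : ArrowMaps B A) : homs A (A.extension B η) :=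
  ⟨fun x => LinearMap.inl ℂ (A.space x) (B.space x), mem_homs.2 fun a w => Prod.ext
    ((congrArg (A.map a w + ·) (map_zero (η a))).trans (add_zero _)) (map_zero (B.map a))⟩

/-- The projection of an extension to its quotient. -/
noncomputable def extensionSnd (η : ArrowMaps B A) : homs (A.extension B η) B :=
  ⟨fun x => LinearMap.snd ℂ (A.space x) (B.space x), mem_homs.2 fun _ _ => rfl⟩

theorem ker_postcomp_extensionSnd_le (X : G.Representation) (η : ArrowMaps B A) :
    LinearMap.ker (postcomp X (extensionSnd η)) ≤
      LinearMap.range (postcomp X (extensionInl η)) := by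
  rintro ⟨f, hf⟩ hfp
  have hsnd : ∀ x w, (f x w).2 = 0 := fun x w =>
    LinearMap.congr_fun (congrFun (congrArg Subtype.val hfp) x) w
  refine ⟨⟨fun x => (LinearMap.fst ℂ (A.space x) (B.space x)).comp (f x), mem_homs.2 fun a w => ?_⟩,
    Subtype.ext (funext fun x => LinearMap.ext fun w => Prod.ext rfl (hsnd x w).symm)⟩
  have hfst : A.map a (f (G.src a) w).1 + η a (f (G.src a) w).2 = (f (G.tgt a) (X.map a w)).1 :=
    congrArg Prod.fst (mem_homs.1 hf a w)
  rwa [hsnd, map_zero, add_zero] at hfst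

theorem extension_apply_mk {X : G.Representation} {η : ArrowMaps B A}
    (f : VertexMaps (A.extension B η) X) (x : V) (w : A.space x) (w' : B.space x) :
    f x (w, w') = f x (w, (0 : B.space x)) + f x ((0 : A.space x), w') := by
  refine Eq.trans (congrArg (f x) (Prod.ext ?_ ?_)) (map_add (f x) _ _)
  · exact (add_zero w).symm
  · exact (zero_add w').symm

theorem ker_precomp_extensionInl_le (η : ArrowMaps B A) (X : G.Representation) :
    LinearMap.ker (precomp (extensionInl η) X) ≤ LinearMap.range (precomp (extensionSnd η) X) := by
  rintro ⟨f, hf⟩ hfi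
  have hinl : ∀ x (w : A.space x), f x (w, (0 : B.space x)) = 0 := fun x w =>
    LinearMap.congr_fun (congrFun (congrArg Subtype.val hfi) x) w
  have hsnd : ∀ x (w : A.space x) (w' : B.space x), f x (w, w') = f x (0, w') := fun x w w' => by
    rw [extension_apply_mk, hinl, zero_add]
  refine ⟨⟨fun x => (f x).comp (LinearMap.inr ℂ (A.space x) (B.space x)), mem_homs.2 fun a w => ?_⟩,
    Subtype.ext (funext fun x => LinearMap.ext fun w => (hsnd x w.1 w.2).symm)⟩
  exact (mem_homs.1 hf a ((0 : A.space (G.src a)), w)).trans (hsnd _ _ _)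

theorem mem_range_differential_of_postcomp_extensionSnd_surjective {η : ArrowMaps B A}
    (h : Function.Surjective (postcomp B (extensionSnd η))) :
    η ∈ LinearMap.range (differential B A) := by
  obtain ⟨⟨s, hs⟩, hsid⟩ := h ⟨_, id_mem_homs B⟩
  have hsnd : ∀ x (w : B.space x), (s x w).2 = w := fun x w =>
    LinearMap.congr_fun (congrFun (congrArg Subtype.val hsid) x) w
  refine ⟨fun x => -(LinearMap.fst ℂ (A.space x) (B.space x)).comp (s x), ?_⟩
  funext a
  ext w
  have hfst : A.map a (s (G.src a) w).1 + η a (s (G.src a) w).2 = (s (G.tgt a) (B.map a w)).1 :=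
    congrArg Prod.fst (mem_homs.1 hs a w)
  rw [hsnd] at hfst
  change A.map a (-(s (G.src a) w).1) - -(s (G.tgt a) (B.map a w)).1 = η a w
  rw [← hfst, map_neg]
  abel

section FiniteVertices

variable [Finite V]

theorem finrank_homs_extension_right_le (X : G.Representation) (η : ArrowMaps B A) :
    Module.finrank ℝ (homs X (A.extension B η)) ≤
      Module.finrank ℝ (homs X A) + Module.finrank ℝ (homs X B) :=
  (finrank_le_of_ker_le_range _ _ (ker_postcomp_extensionSnd_le X η)).trans
    (Nat.add_le_add_left (Submodule.finrank_le _) _)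

theorem finrank_homs_extension_left_le (η : ArrowMaps B A) (X : G.Representation) :
    Module.finrank ℝ (homs (A.extension B η) X) ≤
      Module.finrank ℝ (homs B X) + Module.finrank ℝ (homs A X) :=
  (finrank_le_of_ker_le_range _ _ (ker_precomp_extensionInl_le η X)).trans
    (Nat.add_le_add_left (Submodule.finrank_le _) _)

theorem finrank_homs_extension_right_lt {η : ArrowMaps B A}
    (hη : η ∉ LinearMap.range (differential B A)) :
    Module.finrank ℝ (homs B (A.extension B η)) <
      Module.finrank ℝ (homs B A) + Module.finrank ℝ (homs B B) :=
  (finrank_le_of_ker_le_range _ _ (ker_postcomp_extensionSnd_le B η)).trans_lt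
    (Nat.add_lt_add_left (Submodule.finrank_lt fun htop =>
      hη (mem_range_differential_of_postcomp_extensionSnd_surjective
        (LinearMap.range_eq_top.1 htop))) _)

theorem finrank_homs_directSum_right_ge (X A B : G.Representation) :
    Module.finrank ℝ (homs X A) + Module.finrank ℝ (homs X B) ≤
      Module.finrank ℝ (homs X (A.directSum B)) := by
  rw [← Module.finrank_prod]
  refine LinearMap.finrank_le_finrank_of_surjective
    (f := (postcomp X ⟨_, fst_mem_homs A B⟩).prod (postcomp X ⟨_, snd_mem_homs A B⟩)) ?_
  rintro ⟨f, g⟩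
  exact ⟨⟨fun x => (f.1 x).prod (g.1 x), mem_homs.2 fun a w =>
    Prod.ext (mem_homs.1 f.2 a w) (mem_homs.1 g.2 a w)⟩, rfl⟩

theorem finrank_homs_directSum_left_ge (A B X : G.Representation) :
    Module.finrank ℝ (homs A X) + Module.finrank ℝ (homs B X) ≤
      Module.finrank ℝ (homs (A.directSum B) X) := by
  rw [← Module.finrank_prod]
  refine LinearMap.finrank_le_finrank_of_surjective
    (f := (precomp ⟨_, inl_mem_homs A B⟩ X).prod (precomp ⟨_, inr_mem_homs A B⟩ X)) ?_
  rintro ⟨f, g⟩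
  refine ⟨⟨fun x => (f.1 x).coprod (g.1 x), mem_homs.2 fun a w => ?_⟩, Prod.ext ?_ ?_⟩
  · exact (map_add (X.map a) _ _).trans
      (congrArg₂ (· + ·) (mem_homs.1 f.2 a w.1) (mem_homs.1 g.2 a w.2))
  · exact Subtype.ext (funext fun x => LinearMap.coprod_inl (f.1 x) (g.1 x))
  · exact Subtype.ext (funext fun x => LinearMap.coprod_inr (f.1 x) (g.1 x))

theorem finrank_homs_extension_self_lt {η : ArrowMaps B A}
    (hη : η ∉ LinearMap.range (differential B A)) :
    Module.finrank ℝ (homs (A.extension B η) (A.extension B η)) <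
      Module.finrank ℝ (homs (A.directSum B) (A.directSum B)) := by
  have hleft := finrank_homs_extension_left_le η (A.extension B η)
  have hA := finrank_homs_extension_right_le A η
  have hB := finrank_homs_extension_right_lt hη
  have hleft' := finrank_homs_directSum_left_ge A B (A.directSum B)
  have hA' := finrank_homs_directSum_right_ge A A B
  have hB' := finrank_homs_directSum_right_ge B A B
  lia

theorem Isomorphic.finrank_homs_le (hA : A.Isomorphic M) (hB : B.Isomorphic N) :
    Module.finrank ℝ (homs M N) ≤ Module.finrank ℝ (homs A B) := by
  obtain ⟨f, hf, f', hf', -, hff'⟩ := isomorphic_iff_exists_inverse.1 hA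
  obtain ⟨g, hg, g', hg', -, hgg'⟩ := isomorphic_iff_exists_inverse.1 hB
  refine LinearMap.finrank_le_finrank_of_surjective
    (f := (precomp ⟨f', hf'⟩ N).comp (postcomp A ⟨g, hg⟩)) fun k => ?_
  refine ⟨⟨(g'.comp k.1).comp f, comp_mem_homs (comp_mem_homs hg' k.2) hf⟩,
    Subtype.ext (funext fun x => LinearMap.ext fun w => ?_)⟩
  simp only [LinearMap.comp_apply, precomp_apply, postcomp_apply, VertexMaps.comp_apply, hff', hgg']

end FiniteVertices

theorem exists_dim_eq (G : Biquiver V E) (z : V → ℕ) : ∃ A : G.Representation, A.dim = z :=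
  ⟨{ space := fun x => Fin (z x) → ℂ, map := fun _ => 0 }, funext fun x => by simp [dim]⟩

theorem directSum_comm (A B : G.Representation) :
    (A.directSum B).Isomorphic (B.directSum A) :=
  isomorphic_iff.2 ⟨fun x => (LinearEquiv.prodComm ℂ (A.space x) (B.space x)).toLinearMap,
    mem_homs.2 fun _ _ => rfl, fun x => (LinearEquiv.prodComm ℂ (A.space x) (B.space x)).bijective⟩

theorem exists_dim_eq_forall_differential_surjective [Finite V] (z : V → ℕ) :
    ∃ M : G.Representation, M.dim = z ∧ ∀ A B : G.Representation,
      M.Isomorphic (A.directSum B) → Function.Surjective (differential B A) := by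
  -- A nonsplit extension of `B` by `A` has fewer endomorphisms than their direct sum.
  obtain ⟨M, hM, hmin⟩ := (measure fun A : G.Representation =>
    Module.finrank ℝ (homs A A)).wf.has_min {A | A.dim = z} (exists_dim_eq G z)
  refine ⟨M, hM, fun A B h η => ?_⟩
  by_contra hη
  refine hmin (A.extension B η) ?_
    ((finrank_homs_extension_self_lt hη).trans_le (h.finrank_homs_le h))
  exact (dim_extension η).trans ((dim_directSum A B).symm.trans (h.dim_eq.symm.trans hM))

theorem dimVector_directSum (A B : G.Representation) :
    (A.directSum B).dimVector = A.dimVector + B.dimVector := by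
  funext x
  simp [dimVector, dim_directSum]

section MinimalEndomorphisms

variable [Fintype V] [Fintype E]

theorem eulerForm_nonneg_of_differential_surjective
    (h : Function.Surjective (differential A B)) :
    0 ≤ G.eulerForm A.dimVector B.dimVector := by
  rw [differential_surjective_iff] at h
  lia

theorem exists_dim_eq_forall_titsForm_add_le (G : Biquiver V E) (z : V → ℕ) :
    ∃ M : G.Representation, M.dim = z ∧ ∀ A B : G.Representation,
      M.Isomorphic (A.directSum B) →
        G.titsForm A.dimVector + G.titsForm B.dimVector ≤ G.titsForm M.dimVector := by
  obtain ⟨M, hM, hsurj⟩ := exists_dim_eq_forall_differential_surjective (G := G) z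
  refine ⟨M, hM, fun A B h => ?_⟩
  have hBA := eulerForm_nonneg_of_differential_surjective (hsurj A B h)
  have hAB := eulerForm_nonneg_of_differential_surjective
    (hsurj B A (h.trans (directSum_comm A B)))
  have hdim : M.dimVector = A.dimVector + B.dimVector :=
    (funext fun x => congrArg Nat.cast (congrFun h.dim_eq x)).trans (dimVector_directSum A B)
  rw [hdim, ← eulerForm_self, ← eulerForm_self, ← eulerForm_self]
  simp only [map_add, LinearMap.add_apply]
  lia

theorem exists_indecomposable_of_titsForm_eq_one (hq : G.titsForm.PosDef) {z : V → ℕ}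
    (hz : G.titsForm (fun x => (z x : ℤ)) = 1) :
    ∃ A : G.Representation, A.Indecomposable ∧ A.dim = z := by
  obtain ⟨M, rfl, hM⟩ := exists_dim_eq_forall_titsForm_add_le G z
  refine ⟨M, ⟨fun h0 => ?_, ?_⟩, rfl⟩
  · rw [h0] at hz
    exact zero_ne_one ((map_zero G.titsForm).symm.trans hz)
  · rintro ⟨A, B, hA, hB, h⟩
    have hle : _ ≤ (1 : ℤ) := (hM A B h).trans_eq hz
    have hposA := titsForm_dimVector_pos hq hA
    have hposB := titsForm_dimVector_pos hq hB
    lia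

end MinimalEndomorphisms

/-! ### Uniqueness -/

theorem differential_surjective_of_injective {i : VertexMaps A B} (hi : i ∈ homs A B)
    (hinj : ∀ x, Function.Injective (i x)) (h : Function.Surjective (differential B X)) :
    Function.Surjective (differential A X) := by
  intro η
  choose k hk using fun a => exists_semilinear_comp_eq (i (G.src a)) (η a)
    ((LinearMap.ker_eq_bot.2 (hinj _)).trans_le bot_le)
  obtain ⟨f, rfl⟩ := h k
  refine ⟨f.comp i, funext fun a => LinearMap.ext fun w => ?_⟩
  rw [← hk, differential_apply, differential_apply, mem_homs.1 hi, VertexMaps.comp_apply,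
    VertexMaps.comp_apply]

theorem dimVector_subrep_ker_add_dimVector_subrep_range {f : VertexMaps A B}
    (hf : f ∈ homs A B) :
    (A.subrep f.ker (isInvariant_ker hf)).dimVector +
      (B.subrep f.range (isInvariant_range hf)).dimVector = A.dimVector := by
  funext x
  have h := LinearMap.finrank_range_add_finrank_ker (f x)
  rw [add_comm] at h
  exact (Nat.cast_add _ _).symm.trans (congrArg Nat.cast h)

section PosDef

variable [Fintype V] [Fintype E]

theorem IsBrick.eulerForm_pos_of_injective (hq : G.titsForm.PosDef) (hB : B.IsBrick)
    {i : VertexMaps A B} (hi : i ∈ homs A B) (hinj : ∀ x, Function.Injective (i x))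
    (hA : A.dim ≠ 0) : 0 < G.eulerForm A.dimVector B.dimVector := by
  have hsurj := differential_surjective_of_injective hi hinj (hB.differential_surjective hq)
  have hi0 : (⟨i, hi⟩ : homs A B) ≠ 0 := fun h0 => by
    obtain ⟨x, w, hw⟩ := exists_ne_zero_of_dim_ne_zero hA
    exact hw (hinj x ((LinearMap.congr_fun (congrFun (congrArg Subtype.val h0) x) w).trans
      (map_zero (i x)).symm))
  have hpos : 0 < Module.finrank ℝ (homs A B) := Module.finrank_pos_iff_exists_ne_zero.2 ⟨_, hi0⟩
  rw [differential_surjective_iff] at hsurj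
  lia

theorem IsBrick.isomorphic_of_dim_eq (hq : G.titsForm.PosDef) (hA : A.IsBrick) (hB : B.IsBrick)
    (h : A.dim = B.dim) : A.Isomorphic B := by
  have hAB : A.dimVector = B.dimVector := funext fun x => congrArg Nat.cast (congrFun h x)
  have hone : G.eulerForm A.dimVector B.dimVector = 1 := by
    rw [← hAB, eulerForm_self, hA.titsForm_dimVector hq]
  obtain ⟨⟨f, hf⟩, hf0⟩ : ∃ f : homs A B, f ≠ 0 := by
    have hle := two_mul_eulerForm_le_finrank_homs A B
    have hpos : 0 < Module.finrank ℝ (homs A B) := by lia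
    exact Module.finrank_pos_iff_exists_ne_zero.1 hpos
  -- The kernel embeds in `A` and the image in `B`, so the Euler form would split `1` as a sum of
  -- two positive integers if both were nonzero.
  by_cases hK : (A.subrep f.ker (isInvariant_ker hf)).dim = 0
  · have hinj : ∀ x, Function.Injective (f x) := fun x =>
      (injective_iff_map_eq_zero (f x)).2 fun w hw =>
        congrArg Subtype.val ((dim_eq_zero_iff _).1 hK x ⟨w, hw⟩)
    exact isomorphic_iff.2 ⟨f, hf, fun x => ⟨hinj x,
      (LinearMap.injective_iff_surjective_of_finrank_eq_finrank (congrFun h x)).1 (hinj x)⟩⟩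
  · have hI : (B.subrep f.range (isInvariant_range hf)).dim ≠ 0 := fun hI => by
      obtain ⟨x, w, hw⟩ := exists_ne_zero_of_ne_zero fun h0 => hf0 (Subtype.ext h0)
      exact hw (congrArg Subtype.val ((dim_eq_zero_iff _).1 hI x ⟨f x w, w, rfl⟩))
    have hKpos := hA.eulerForm_pos_of_injective hq (subtype_mem_homs _)
      (fun _ => Subtype.val_injective) hK
    have hIpos := hB.eulerForm_pos_of_injective hq (subtype_mem_homs _)
      (fun _ => Subtype.val_injective) hI
    rw [hAB] at hKpos
    rw [← dimVector_subrep_ker_add_dimVector_subrep_range hf, map_add, LinearMap.add_apply] at hone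
    lia

end PosDef

end Representation

section Finiteness

variable [Fintype V] [Fintype E]

theorem titsForm_single_le [DecidableEq V] (G : Biquiver V E) (x : V) :
    G.titsForm (Pi.single x 1) ≤ 1 := by
  convert titsForm_indicator_singleton_le G x using 2
  funext y
  simp [indicator, Pi.single_apply]

theorem abs_polar_single_le [DecidableEq V] (hq : G.titsForm.PosDef) {z : V → ℤ}
    (hz : G.titsForm z = 1) (x : V) :
    |QuadraticMap.polar G.titsForm z (Pi.single x 1)| ≤ 2 := by
  have hadd := hq.nonneg (z + Pi.single x 1)
  have hsub := hq.nonneg (z + -Pi.single x 1)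
  have hsingle := titsForm_single_le G x
  rw [QuadraticMap.map_add G.titsForm] at hadd hsub
  rw [QuadraticMap.polar_neg_right, QuadraticMap.map_neg] at hsub
  exact abs_le.2 ⟨by lia, by lia⟩

theorem eq_of_forall_polar_single_eq [DecidableEq V] (hq : G.titsForm.PosDef) {y z : V → ℤ}
    (h : ∀ x, QuadraticMap.polar G.titsForm y (Pi.single x 1) =
      QuadraticMap.polar G.titsForm z (Pi.single x 1)) : y = z := by
  have hpolar : G.titsForm.polarBilin (y - z) = 0 :=
    LinearMap.pi_ext' fun x => LinearMap.ext_ring (by simp [h x])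
  have hself := LinearMap.congr_fun hpolar (y - z)
  rw [QuadraticMap.polarBilin_apply_apply, QuadraticMap.polar_self] at hself
  exact sub_eq_zero.1 (hq.anisotropic _ (by simpa using hself))

theorem finite_setOf_titsForm_eq_one (hq : G.titsForm.PosDef) :
    {z : V → ℤ | G.titsForm z = 1}.Finite := by
  classical
  refine Set.Finite.of_injOn (f := fun z x => QuadraticMap.polar G.titsForm z (Pi.single x 1))
    (t := Set.pi Set.univ fun _ => Set.Icc (-2) 2) (fun z hz x _ => ?_) (fun y _ z _ h => ?_)
    (Set.Finite.pi fun _ => Set.finite_Icc _ _)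
  · exact abs_le.1 (abs_polar_single_le hq hz x)
  · exact eq_of_forall_polar_single_eq hq (congrFun h)

theorem representationFinite_of_posDef (hq : G.titsForm.PosDef) : G.RepresentationFinite := by
  let roots := {z : V → ℕ | G.titsForm (fun x => (z x : ℤ)) = 1}
  have : Finite roots := (finite_setOf_titsForm_eq_one hq).preimage
    (Function.Injective.comp_left Nat.cast_injective).injOn
  choose R hR hRdim using fun z : roots =>
    Representation.exists_indecomposable_of_titsForm_eq_one hq z.2
  refine ⟨Set.range R, Set.finite_range R, fun A hA => ?_⟩
  have hA' := hA.isBrick hq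
  let z : roots := ⟨A.dim, hA'.titsForm_dimVector hq⟩
  exact ⟨R z, ⟨z, rfl⟩, hA'.isomorphic_of_dim_eq hq ((hR z).isBrick hq) (hRdim z).symm⟩

end Finiteness

/-! ### Self-extensions and representation-infinite biquivers -/

namespace Representation

variable {A B C X Y : G.Representation}

theorem differential_surjective_of_surjective {p : VertexMaps B C} (hp : p ∈ homs B C)
    (hsurj : ∀ x, Function.Surjective (p x)) (h : Function.Surjective (differential A B)) :
    Function.Surjective (differential A C) := by
  intro η
  choose s hs using fun x =>
    (p x).exists_rightInverse_of_surjective (LinearMap.range_eq_top.2 (hsurj x))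
  obtain ⟨f, hf⟩ := h fun a => (s (G.tgt a)).comp (η a)
  refine ⟨p.comp f, funext fun a => LinearMap.ext fun w => ?_⟩
  have hfw : differential A B f a w = s (G.tgt a) (η a w) :=
    LinearMap.congr_fun (congrFun hf a) w
  rw [differential_apply, VertexMaps.comp_apply, VertexMaps.comp_apply, mem_homs.1 hp, ← map_sub,
    ← differential_apply, hfw]
  exact LinearMap.congr_fun (hs (G.tgt a)) (η a w)

theorem IsBrick.postcomp_injective (hX : X.IsBrick) {u : homs X B} (hu : u ≠ 0) :
    Function.Injective (postcomp X u) := by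
  refine (injective_iff_map_eq_zero _).2 fun f huf => ?_
  by_contra hf0
  refine hu (Subtype.ext (funext fun x => LinearMap.ext fun w => ?_))
  obtain ⟨w, rfl⟩ := (hX.2 f f.2 (fun h => hf0 (Subtype.ext h)) x).2 w
  exact LinearMap.congr_fun (congrFun (congrArg Subtype.val huf) x) w

theorem IsBrick.postcomp_extensionSnd_eq_zero (hB : B.IsBrick) {η : ArrowMaps B A}
    (hη : η ∉ LinearMap.range (differential B A)) : postcomp B (extensionSnd η) = 0 := by
  by_contra h0
  obtain ⟨f, hf⟩ := DFunLike.ne_iff.1 h0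
  -- A nonzero composite `B → A.extension B η → B` would be invertible and split the extension.
  obtain ⟨g, hg, -, hfg⟩ := exists_inverse_mem_homs (postcomp B (extensionSnd η) f).2
    (hB.2 _ (Subtype.prop _) fun h => hf (Subtype.ext h))
  refine hη (mem_range_differential_of_postcomp_extensionSnd_surjective fun e =>
    ⟨⟨f.1.comp (g.comp e.1), comp_mem_homs f.2 (comp_mem_homs hg e.2)⟩, ?_⟩)
  exact Subtype.ext (funext fun x => LinearMap.ext fun w => hfg x (e.1 x w))

/-- The representations obtained from `X` by successive nonsplit extensions of `X` by the
representation already built. -/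
inductive IsTower (X : G.Representation) : G.Representation → Prop
  | refl : IsTower X X
  | extend {Y : G.Representation} {η : ArrowMaps X Y} (hY : IsTower X Y)
      (hη : η ∉ LinearMap.range (differential X Y)) : IsTower X (Y.extension X η)

theorem IsTower.exists_surjective (h : IsTower X Y) :
    ∃ p ∈ homs Y X, ∀ x, Function.Surjective (p x) := by
  cases h with
  | refl => exact ⟨_, id_mem_homs X, fun _ => Function.surjective_id⟩
  | extend _ _ => exact ⟨_, (extensionSnd _).2, fun _ => LinearMap.snd_surjective⟩

theorem exists_isTower (hX : ¬ Function.Surjective (differential X X)) (n : ℕ) :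
    ∃ Y, IsTower X Y ∧ Y.dim = (n + 1) • X.dim := by
  induction n with
  | zero => exact ⟨X, .refl, by rw [zero_add, one_smul]⟩
  | succ n ih =>
    obtain ⟨Y, hY, hdim⟩ := ih
    obtain ⟨p, hp, hsurj⟩ := hY.exists_surjective
    obtain ⟨η, hη⟩ := not_forall.1 fun h => hX (differential_surjective_of_surjective hp hsurj h)
    exact ⟨_, hY.extend hη, by rw [dim_extension, hdim, succ_nsmul _ (n + 1)]⟩

section FiniteVertices

variable [Finite V]

theorem finrank_homs_self_pos (hA : A.dim ≠ 0) : 0 < Module.finrank ℝ (homs A A) := by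
  obtain ⟨x, w, hw⟩ := exists_ne_zero_of_dim_ne_zero hA
  exact Module.finrank_pos_iff_exists_ne_zero.2 ⟨⟨_, id_mem_homs A⟩, fun h =>
    hw (LinearMap.congr_fun (congrFun (congrArg Subtype.val h) x) w)⟩

theorem IsBrick.finrank_homs_self_le (hX : X.IsBrick) (h : 0 < Module.finrank ℝ (homs X B)) :
    Module.finrank ℝ (homs X X) ≤ Module.finrank ℝ (homs X B) := by
  obtain ⟨u, hu⟩ := Module.finrank_pos_iff_exists_ne_zero.1 h
  exact LinearMap.finrank_le_finrank_of_injective (hX.postcomp_injective hu)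

theorem IsTower.finrank_homs_le (h : IsTower X Y) (hX : X.IsBrick) :
    Module.finrank ℝ (homs X Y) ≤ Module.finrank ℝ (homs X X) := by
  induction h with
  | refl => rfl
  | @extend Y η _ hη ih =>
    have hle := finrank_le_of_ker_le_range _ _ (ker_postcomp_extensionSnd_le X η)
    rw [hX.postcomp_extensionSnd_eq_zero hη, LinearMap.range_zero, finrank_bot] at hle
    exact hle.trans ih

theorem IsTower.finrank_homs_pos (h : IsTower X Y) (hYB : 0 < Module.finrank ℝ (homs Y B)) :
    0 < Module.finrank ℝ (homs X B) := by
  induction h with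
  | refl => exact hYB
  | @extend Y η _ _ ih =>
    rcases Nat.eq_zero_or_pos (Module.finrank ℝ (homs Y B)) with h0 | hpos
    · have hle := finrank_homs_extension_left_le η B
      lia
    · exact ih hpos

theorem IsTower.indecomposable (h : IsTower X Y) (hX : X.IsBrick) (hY : Y.dim ≠ 0) :
    Y.Indecomposable := by
  refine ⟨hY, fun ⟨B, C, hB, hC, hiso⟩ => ?_⟩
  have hXB : Module.finrank ℝ (homs X X) ≤ Module.finrank ℝ (homs X B) := by
    have hleft := finrank_homs_directSum_left_ge B C B
    have hYB := hiso.finrank_homs_le (.refl B)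
    have hpos := finrank_homs_self_pos hB
    exact hX.finrank_homs_self_le (h.finrank_homs_pos (by lia))
  have hXC : Module.finrank ℝ (homs X X) ≤ Module.finrank ℝ (homs X C) := by
    have hleft := finrank_homs_directSum_left_ge B C C
    have hYC := hiso.finrank_homs_le (.refl C)
    have hpos := finrank_homs_self_pos hC
    exact hX.finrank_homs_self_le (h.finrank_homs_pos (by lia))
  have hright := finrank_homs_directSum_right_ge X B C
  have hXY := (Isomorphic.refl X).finrank_homs_le hiso
  have hle := h.finrank_homs_le hX
  have hpos := finrank_homs_self_pos hX.1
  lia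

theorem IsBrick.differential_surjective_of_representationFinite (hX : X.IsBrick)
    (hG : G.RepresentationFinite) : Function.Surjective (differential X X) := by
  by_contra hns
  obtain ⟨S, hS, hcover⟩ := hG
  choose T hT hdim using exists_isTower hns
  have hne : ∀ n, (T n).dim ≠ 0 := fun n => by
    rw [hdim]
    exact smul_ne_zero n.succ_ne_zero hX.1
  choose R hRS hR using fun n => hcover _ ((hT n).indecomposable hX (hne n))
  refine Set.infinite_of_injective_forall_mem (f := R) (fun m n hmn => ?_) hRS hS
  have hmul : (m + 1) • X.dim = (n + 1) • X.dim := by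
    rw [← hdim, ← hdim, (hR m).dim_eq, (hR n).dim_eq, hmn]
  obtain ⟨x, hx⟩ := Function.ne_iff.1 hX.1
  exact Nat.succ_injective (Nat.eq_of_mul_eq_mul_right (Nat.pos_of_ne_zero hx) (congrFun hmul x))

theorem Indecomposable.differential_surjective (hX : X.Indecomposable)
    (hG : G.RepresentationFinite) : Function.Surjective (differential X X) :=
  (hX.isBrick_of_forall_differential_surjective fun _ hY =>
    hY.differential_surjective_of_representationFinite hG)
    |>.differential_surjective_of_representationFinite hG

end FiniteVertices

end Representation

section PosDef

variable [Fintype V] [Fintype E]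

theorem RepresentationFinite.titsForm_dimVector_pos (hG : G.RepresentationFinite)
    {A : G.Representation} (hA : A.dim ≠ 0) : 0 < G.titsForm A.dimVector := by
  induction hn : A.totalDim using Nat.strong_induction_on generalizing A with
  | _ n ih =>
    obtain ⟨M, hM, hadd⟩ := Representation.exists_dim_eq_forall_titsForm_add_le G A.dim
    have hMA : M.dimVector = A.dimVector := funext fun x => congrArg Nat.cast (congrFun hM x)
    rw [← hMA]
    by_cases hind : M.Indecomposable
    · have heq := (Representation.differential_surjective_iff M M).1
        (hind.differential_surjective hG)
      have hpos := Representation.finrank_homs_self_pos hind.1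
      rw [eulerForm_self] at heq
      lia
    · obtain ⟨B, C, hB, hC, hiso⟩ : ∃ B C : G.Representation, B.dim ≠ 0 ∧ C.dim ≠ 0 ∧
          M.Isomorphic (B.directSum C) := by
        by_contra h
        exact hind ⟨hM ▸ hA, h⟩
      have hle := hadd B C hiso
      have htot : B.totalDim + C.totalDim = n := by
        rw [← Representation.totalDim_directSum, ← hiso.totalDim_eq, ← hn,
          Representation.totalDim, hM, Representation.totalDim]
      have hBpos := Representation.totalDim_pos hB
      have hCpos := Representation.totalDim_pos hC
      have hqB := ih _ (by lia) hB rfl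
      have hqC := ih _ (by lia) hC rfl
      lia

theorem titsForm_abs_le (G : Biquiver V E) (z : V → ℤ) : G.titsForm |z| ≤ G.titsForm z := by
  simp only [titsForm_apply, Pi.abs_apply, sq_abs, ← abs_mul]
  exact sub_le_sub_left (Finset.sum_le_sum fun _ _ => le_abs_self _) _

theorem RepresentationFinite.posDef (hG : G.RepresentationFinite) : G.titsForm.PosDef := by
  intro z hz
  obtain ⟨A, hA⟩ := Representation.exists_dim_eq G fun x => (z x).natAbs
  have hdim : A.dimVector = |z| := funext fun x =>
    (congrArg Nat.cast (congrFun hA x)).trans (Int.natCast_natAbs (z x))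
  refine (hdim ▸ hG.titsForm_dimVector_pos fun h0 => hz ?_).trans_le (titsForm_abs_le G z)
  exact funext fun x => Int.natAbs_eq_zero.1 ((congrFun hA x).symm.trans (congrFun h0 x))

end PosDef

/-! ### Dynkin diagrams -/

theorem adj_iff {x y : V} : G.toSimpleGraph.Adj x y ↔
    x ≠ y ∧ ∃ a, s(G.src a, G.tgt a) = s(x, y) := by
  simp only [toSimpleGraph, SimpleGraph.fromRel_adj, Sym2.eq_iff, exists_or]

theorem branchGraph_adj {n k : ℕ} {i j : Fin n} : (branchGraph n k).Adj i j ↔ i ≠ j ∧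
    (((i.val + 1 = j.val ∧ j.val + 1 < n) ∨ (i.val = k ∧ j.val + 1 = n)) ∨
      ((j.val + 1 = i.val ∧ i.val + 1 < n) ∨ (j.val = k ∧ i.val + 1 = n))) := by
  rw [branchGraph, SimpleGraph.fromRel_adj]

section ParentFunctions

variable {m : ℕ} {D : SimpleGraph (Fin (m + 1))} {p : ℕ → ℕ}

/-- The graph `D` is a tree in which every vertex `i + 1` is joined to exactly one smaller vertex,
its parent `p i`. -/
structure IsParentFunction (D : SimpleGraph (Fin (m + 1))) (p : ℕ → ℕ) : Prop where
  le : ∀ i, p i ≤ i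
  adj_iff : ∀ (x : Fin (m + 1)) (i : Fin m), x < i.succ → (D.Adj x i.succ ↔ x.val = p i)

theorem isParentFunction_pathGraph (m : ℕ) :
    IsParentFunction (SimpleGraph.pathGraph (m + 1)) id where
  le _ := le_rfl
  adj_iff x i hx := by
    rw [Fin.lt_def, Fin.val_succ] at hx
    rw [SimpleGraph.pathGraph_adj, Fin.val_succ, id]
    lia

theorem isParentFunction_branchGraph {m k : ℕ} (hk : k ≤ m) :
    IsParentFunction (branchGraph (m + 2) k) (fun i => if i < m then i else min i k) where
  le i := by split_ifs <;> lia
  adj_iff x i hx := by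
    rw [Fin.lt_def, Fin.val_succ] at hx
    rw [branchGraph_adj, Fin.val_succ, Ne, Fin.ext_iff, Fin.val_succ]
    split_ifs <;> lia

/-- The edge joining `i + 1` to its parent. -/
def IsParentFunction.edge (hp : IsParentFunction D p) (i : Fin m) : D.edgeSet :=
  ⟨s(⟨p i, (hp.le i).trans_lt (by lia)⟩, i.succ),
    (hp.adj_iff _ i (Nat.lt_succ_of_le (hp.le i))).2 rfl⟩

theorem IsParentFunction.edge_bijective (hp : IsParentFunction D p) :
    Function.Bijective hp.edge := by
  refine ⟨fun i j h => ?_, ?_⟩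
  · have hi := hp.le i
    have hj := hp.le j
    have h' := congrArg Subtype.val h
    simp only [edge, Sym2.eq_iff, Fin.ext_iff, Fin.val_succ] at h'
    lia
  · rintro ⟨e, he⟩
    induction e with
    | _ x y =>
      wlog hxy : x < y generalizing x y
      · rw [Sym2.eq_swap] at he
        obtain ⟨i, hi⟩ := this y x he (lt_of_le_of_ne (not_lt.1 hxy) (D.ne_of_adj he))
        exact ⟨i, hi.trans (Subtype.ext Sym2.eq_swap)⟩
      obtain ⟨i, rfl⟩ := Fin.exists_succ_eq.2 (Fin.ne_zero_of_lt hxy)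
      exact ⟨i, Subtype.ext (congrArg (s(·, i.succ)) (Fin.ext ((hp.adj_iff x i hxy).1 he).symm))⟩

theorem IsParentFunction.connected (hp : IsParentFunction D p) : D.Connected := by
  rw [SimpleGraph.connected_iff_exists_forall_reachable]
  refine ⟨0, fun x => ?_⟩
  induction hx : x.val using Nat.strong_induction_on generalizing x with
  | _ n ih =>
    cases x using Fin.cases with
    | zero => rfl
    | succ i =>
      have hlt : p i < i.val + 1 := Nat.lt_succ_of_le (hp.le i)
      exact (ih (p i) (hx ▸ hlt) ⟨p i, hlt.trans (by lia)⟩ rfl).trans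
        (SimpleGraph.Adj.reachable (hp.edge i).2)

theorem IsObtainedFrom.connected_iff {W : Type*} {D : SimpleGraph W} (h : G.IsObtainedFrom D) :
    G.Connected ↔ D.Connected := by
  obtain ⟨f, g, hg⟩ := h
  refine SimpleGraph.Iso.connected_iff ⟨f, fun {x y} => ?_⟩
  rw [adj_iff, ← SimpleGraph.mem_edgeSet]
  constructor
  · intro hD
    obtain ⟨a, ha⟩ := g.surjective ⟨_, hD⟩
    refine ⟨fun hxy => D.ne_of_adj hD (congrArg f hxy), a, Sym2.map.injective f.injective ?_⟩
    exact (hg a).symm.trans (congrArg Subtype.val ha)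
  · rintro ⟨-, a, ha⟩
    have hmap := congrArg (Sym2.map f) ha
    rw [Sym2.map_mk, Sym2.map_mk] at hmap
    exact hmap ▸ hg a ▸ (g a).2

variable [Fintype V] [Fintype E]

theorem IsObtainedFrom.exists_titsForm_eq (h : G.IsObtainedFrom D) (hp : IsParentFunction D p) :
    ∃ f : V ≃ Fin (m + 1), ∀ y : ℕ → ℤ, G.titsForm (fun x => y (f x)) =
      ∑ i ∈ Finset.range (m + 1), y i ^ 2 - ∑ i ∈ Finset.range m, y (p i) * y (i + 1) := by
  obtain ⟨f, g, hg⟩ := h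
  refine ⟨f, fun y => ?_⟩
  let prod : Sym2 (Fin (m + 1)) → ℤ := Sym2.lift ⟨fun i j => y i * y j, fun _ _ => mul_comm _ _⟩
  have hprod : ∀ a, y (f (G.src a)) * y (f (G.tgt a)) = prod (g a) := fun a => by rw [hg]; rfl
  simp only [titsForm_apply, hprod]
  rw [f.sum_comp fun i => y i ^ 2, Fin.sum_univ_eq_sum_range (fun i => y i ^ 2),
    ← Fin.sum_univ_eq_sum_range fun i => y (p i) * y (i + 1)]
  let e := Equiv.ofBijective _ hp.edge_bijective
  rw [← (g.trans e.symm).sum_comp]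
  refine congrArg _ (Finset.sum_congr rfl fun a _ => ?_)
  exact congrArg (fun b : D.edgeSet => prod b) (e.apply_symm_apply (g a)).symm

theorem IsObtainedFrom.posDef (h : G.IsObtainedFrom D) (hp : IsParentFunction D p)
    (hpos : ∀ y : ℕ → ℤ,
      ∑ i ∈ Finset.range (m + 1), y i ^ 2 - ∑ i ∈ Finset.range m, y (p i) * y (i + 1) ≤ 0 →
      ∀ i ≤ m, y i = 0) : G.titsForm.PosDef := by
  obtain ⟨f, hf⟩ := h.exists_titsForm_eq hp
  intro z hz
  by_contra! hneg
  let y : ℕ → ℤ := Function.extend Fin.val (z ∘ f.symm) 0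
  have hy : ∀ x, y (f x) = z x := fun x => by
    simp only [y, Fin.val_injective.extend_apply, Function.comp_apply, Equiv.symm_apply_apply]
  have hle := hf y
  simp only [hy] at hle
  exact hz (funext fun x => (hy x).symm.trans (hpos y (hle ▸ hneg) _ (f x).is_le))

end ParentFunctions

/-- The part of the Tits form contributed by an arm `y 0 — ⋯ — y (m - 1)` that is attached to a
vertex with coordinate `y m`. -/
def armForm (m : ℕ) (y : ℕ → ℤ) : ℤ := ∑ i ∈ Finset.range m, y i * (y i - y (i + 1))

theorem armForm_succ_identity (m : ℕ) (y : ℕ → ℤ) :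
    (m + 1) * (2 * (m + 2) * armForm (m + 1) y + (m + 1) * y (m + 1) ^ 2) =
      (m + 2) * (2 * (m + 1) * armForm m y + m * y m ^ 2) +
        ((m + 2) * y m - (m + 1) * y (m + 1)) ^ 2 := by
  rw [armForm, Finset.sum_range_succ, ← armForm]
  ring

theorem armForm_add_sq_nonneg (m : ℕ) (y : ℕ → ℤ) :
    0 ≤ 2 * (m + 1) * armForm m y + m * y m ^ 2 := by
  induction m with
  | zero => simp [armForm]
  | succ m ih =>
    have hid := armForm_succ_identity m y
    push_cast
    refine nonneg_of_mul_nonneg_right (a := (m + 1 : ℤ)) ?_ (by positivity)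
    rw [show (m + 1 + 1 : ℤ) = m + 2 by ring, hid]
    positivity

theorem eq_zero_of_armForm_nonpos {m : ℕ} {y : ℕ → ℤ} (hm : y m = 0) (h : armForm m y ≤ 0) :
    ∀ i ≤ m, y i = 0 := by
  induction m with
  | zero =>
    intro i hi
    rwa [Nat.le_zero.1 hi]
  | succ m ih =>
    have hid := armForm_succ_identity m y
    have hnonneg := armForm_add_sq_nonneg m y
    rw [hm] at hid
    have hym : y m = 0 := by
      have hleft : (m + 1 : ℤ) * (2 * (m + 2) * armForm (m + 1) y) ≤ 0 :=
        mul_nonpos_of_nonneg_of_nonpos (by positivity)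
          (mul_nonpos_of_nonneg_of_nonpos (by positivity) h)
      have hright := mul_nonneg (by positivity : (0 : ℤ) ≤ m + 2) hnonneg
      have hsq : ((m + 2 : ℤ) * y m) ^ 2 ≤ 0 := by linarith
      exact (mul_eq_zero.1 (sq_nonpos_iff _ |>.1 hsq)).resolve_left (by positivity)
    have harm : armForm m y ≤ 0 := by
      rwa [armForm, Finset.sum_range_succ, ← armForm, hym, zero_mul, add_zero] at h
    intro i hi
    rcases Nat.le_succ_iff.1 hi with hi | rfl
    · exact ih hym harm i hi
    · exact hm

theorem sum_sq_sub_sum_mul_eq_armForm (m : ℕ) (y : ℕ → ℤ) :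
    ∑ i ∈ Finset.range (m + 1), y i ^ 2 - ∑ i ∈ Finset.range m, y i * y (i + 1) =
      armForm m y + y m ^ 2 := by
  rw [Finset.sum_range_succ, armForm]
  simp only [mul_sub, Finset.sum_sub_distrib, sq]
  ring

theorem armForm_reverse (r k : ℕ) (y : ℕ → ℤ) :
    armForm r (fun i => y (k + r - i)) =
      ∑ i ∈ Finset.range r, y (k + i + 1) * (y (k + i + 1) - y (k + i)) := by
  rw [armForm, ← Finset.sum_range_reflect]
  refine Finset.sum_congr rfl fun i hi => ?_
  have hi' := Finset.mem_range.1 hi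
  simp only [show k + r - (r - 1 - i) = k + i + 1 by lia,
    show k + r - (r - 1 - i + 1) = k + i by lia]

theorem armForm_add (k r : ℕ) (y : ℕ → ℤ) :
    armForm (k + r) y + y (k + r) ^ 2 =
      armForm k y + y k ^ 2 + armForm r (fun i => y (k + r - i)) := by
  rw [armForm_reverse]
  induction r with
  | zero => simp
  | succ r ih =>
    rw [← add_assoc k r 1, armForm, Finset.sum_range_succ, Finset.sum_range_succ, ← armForm]
    linear_combination ih

theorem armForm_nonneg {m : ℕ} {y : ℕ → ℤ} (hm : y m = 0) : 0 ≤ armForm m y := by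
  have h := armForm_add_sq_nonneg m y
  rw [hm, zero_pow two_ne_zero, mul_zero, add_zero] at h
  exact nonneg_of_mul_nonneg_right h (by positivity)

theorem eq_zero_of_sq_add_armForm_nonpos {m : ℕ} {y : ℕ → ℤ}
    (h : armForm m y + y m ^ 2 ≤ 0) : ∀ i ≤ m, y i = 0 := by
  have hsq := sq_nonneg (y m)
  have hm : y m = 0 := by
    have harm := armForm_add_sq_nonneg m y
    have hmul := mul_nonpos_of_nonneg_of_nonpos (by positivity : (0 : ℤ) ≤ 2 * (m + 1)) h
    have hmsq : (m + 2 : ℤ) * y m ^ 2 ≤ 0 := by linarith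
    exact sq_nonpos_iff _ |>.1 (nonpos_of_mul_nonpos_right hmsq (by positivity))
  exact eq_zero_of_armForm_nonpos hm (by linarith)

/-- The hypothesis on the lengths is `1 / a + 1 / b + 1 / c > 1` with `a = k + 1`, `b = r + 1` and
`c = s + 1`. -/
theorem eq_zero_of_sq_add_three_armForm_nonpos {k r s : ℕ} {x y z : ℕ → ℤ}
    (hkrs : (k + 1) * (r + 1) * (s + 1) <
      (r + 1) * (s + 1) + (k + 1) * (s + 1) + (k + 1) * (r + 1))
    (hy : y r = x k) (hz : z s = x k)
    (h : x k ^ 2 + armForm k x + armForm r y + armForm s z ≤ 0) :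
    (∀ i ≤ k, x i = 0) ∧ (∀ i ≤ r, y i = 0) ∧ ∀ i ≤ s, z i = 0 := by
  have hu : x k = 0 := by
    have hx' := mul_nonneg (by positivity : (0 : ℤ) ≤ (r + 1) * (s + 1)) (armForm_add_sq_nonneg k x)
    have hy' := mul_nonneg (by positivity : (0 : ℤ) ≤ (k + 1) * (s + 1)) (armForm_add_sq_nonneg r y)
    have hz' := mul_nonneg (by positivity : (0 : ℤ) ≤ (k + 1) * (r + 1)) (armForm_add_sq_nonneg s z)
    have hle := mul_nonpos_of_nonneg_of_nonpos
      (by positivity : (0 : ℤ) ≤ 2 * ((k + 1) * (r + 1) * (s + 1))) h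
    rw [hy] at hy'
    rw [hz] at hz'
    zify at hkrs
    have hmul : (((r + 1) * (s + 1) + (k + 1) * (s + 1) + (k + 1) * (r + 1) : ℤ) -
        (k + 1) * (r + 1) * (s + 1)) * x k ^ 2 ≤ 0 := by linarith
    exact sq_nonpos_iff _ |>.1 (nonpos_of_mul_nonpos_right hmul (sub_pos.2 hkrs))
  have hx0 := armForm_nonneg hu
  have hy0 := armForm_nonneg (hy.trans hu)
  have hz0 := armForm_nonneg (hz.trans hu)
  rw [hu] at h
  exact ⟨eq_zero_of_armForm_nonpos hu (by linarith),
    eq_zero_of_armForm_nonpos (hy.trans hu) (by linarith),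
    eq_zero_of_armForm_nonpos (hz.trans hu) (by linarith)⟩

section Dynkin

variable [Fintype V] [Fintype E]

theorem IsObtainedFrom.posDef_of_pathGraph {m : ℕ}
    (h : G.IsObtainedFrom (SimpleGraph.pathGraph (m + 1))) : G.titsForm.PosDef := by
  refine h.posDef (isParentFunction_pathGraph m) fun y hy => eq_zero_of_sq_add_armForm_nonpos ?_
  rwa [← sum_sq_sub_sum_mul_eq_armForm]

theorem IsObtainedFrom.posDef_of_branchGraph {k r : ℕ}
    (hkr : (k + 1) * (r + 1) < 2 * (k + r + 2))
    (h : G.IsObtainedFrom (branchGraph (k + r + 2) k)) : G.titsForm.PosDef := by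
  refine h.posDef (isParentFunction_branchGraph (Nat.le_add_right k r)) fun y hy => ?_
  have hsum : ∑ i ∈ Finset.range (k + r), y (if i < k + r then i else min i k) * y (i + 1) =
      ∑ i ∈ Finset.range (k + r), y i * y (i + 1) :=
    Finset.sum_congr rfl fun i hi => by rw [if_pos (Finset.mem_range.1 hi)]
  rw [Finset.sum_range_succ _ (k + r + 1), Finset.sum_range_succ (fun i => _ * y (i + 1)), hsum,
    if_neg (lt_irrefl _), min_eq_right (Nat.le_add_right k r)] at hy
  have hpath := sum_sq_sub_sum_mul_eq_armForm (k + r) y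
  rw [armForm_add] at hpath
  let leaf : ℕ → ℤ := fun i => if i = 0 then y (k + r + 1) else y k
  have hleaf : armForm 1 leaf = y (k + r + 1) ^ 2 - y k * y (k + r + 1) := by
    simp only [armForm, leaf, Finset.sum_range_one, if_true, zero_add, one_ne_zero, if_false]
    ring
  obtain ⟨hleft, hright, hlast⟩ := eq_zero_of_sq_add_three_armForm_nonpos (k := k) (r := r)
    (s := 1) (x := y) (y := fun i => y (k + r - i)) (z := leaf) (by lia)
    (congrArg y (Nat.add_sub_cancel k r)) rfl (by linarith)
  intro i hi
  rcases le_or_gt i k with hik | hik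
  · exact hleft i hik
  rcases hi.lt_or_eq with hi | rfl
  · simpa only [Nat.sub_sub_self (Nat.le_of_lt_succ hi)] using hright (k + r - i) (by lia)
  · exact hlast 0 zero_le_one

theorem IsDynkin.posDef (h : G.IsDynkin) : G.titsForm.PosDef := by
  rcases h with ⟨n, hn, h⟩ | ⟨n, hn, h⟩ | h | h | h
  · obtain ⟨m, rfl⟩ := Nat.exists_eq_add_of_le' hn
    exact h.posDef_of_pathGraph
  · obtain ⟨m, rfl⟩ := Nat.exists_eq_add_of_le' hn
    exact IsObtainedFrom.posDef_of_branchGraph (k := m + 1) (r := 1) (by lia) h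
  · exact IsObtainedFrom.posDef_of_branchGraph (k := 2) (r := 2) (by norm_num) h
  · exact IsObtainedFrom.posDef_of_branchGraph (k := 2) (r := 3) (by norm_num) h
  · exact IsObtainedFrom.posDef_of_branchGraph (k := 2) (r := 4) (by norm_num) h

end Dynkin

theorem IsDynkin.connected (h : G.IsDynkin) : G.Connected := by
  have hbranch : ∀ {m k : ℕ}, k ≤ m → G.IsObtainedFrom (branchGraph (m + 2) k) → G.Connected :=
    fun hk h => h.connected_iff.2 (isParentFunction_branchGraph hk).connected
  rcases h with ⟨n, hn, h⟩ | ⟨n, hn, h⟩ | h | h | h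
  · obtain ⟨m, rfl⟩ := Nat.exists_eq_add_of_le' hn
    exact h.connected_iff.2 (isParentFunction_pathGraph m).connected
  · obtain ⟨m, rfl⟩ := Nat.exists_eq_add_of_le' hn
    exact hbranch (m := m + 2) (k := m + 1) (by lia) h
  · exact hbranch (m := 4) (k := 2) (by lia) h
  · exact hbranch (m := 5) (k := 2) (by lia) h
  · exact hbranch (m := 6) (k := 2) (by lia) h

/-! ### Trees in biquivers with positive definite Tits form -/

theorem Connected.exists_adj (hG : G.Connected) {S : Set V} (hS : S.Nonempty) {y : V}
    (hy : y ∉ S) : ∃ x ∈ S, ∃ z ∉ S, G.toSimpleGraph.Adj x z := by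
  obtain ⟨x, hx⟩ := hS
  obtain ⟨p⟩ := hG.preconnected x y
  obtain ⟨d, -, hfst, hsnd⟩ := p.exists_boundary_dart S hx hy
  exact ⟨d.fst, hfst, d.snd, hsnd, d.adj⟩

theorem mem_arrows_or_mem_arrows_of_ends_eq [Fintype E] [DecidableEq V] {S : Finset V} {s y : V}
    (hs : s ∈ S) {a : E} (ha : s(G.src a, G.tgt a) = s(s, y)) :
    a ∈ G.arrows S {y} ∨ a ∈ G.arrows {y} S := by
  simp only [mem_arrows, Finset.mem_singleton]
  rcases Sym2.eq_iff.1 ha with ⟨rfl, rfl⟩ | ⟨rfl, rfl⟩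
  · exact Or.inl ⟨hs, rfl⟩
  · exact Or.inr ⟨rfl, hs⟩

theorem card_le_card_arrows_add_card_arrows [Fintype E] [DecidableEq V] {T N : Finset V}
    (hN : ∀ n ∈ N, ∃ s ∈ T, G.toSimpleGraph.Adj s n) :
    N.card ≤ (G.arrows T N).card + (G.arrows N T).card := by
  have hsub : N ⊆ (G.arrows T N).image G.tgt ∪ (G.arrows N T).image G.src := fun n hn => by
    obtain ⟨s, hs, hadj⟩ := hN n hn
    obtain ⟨-, a, ha⟩ := adj_iff.1 hadj
    rw [Finset.mem_union, Finset.mem_image, Finset.mem_image]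
    rcases Sym2.eq_iff.1 ha with ⟨rfl, rfl⟩ | ⟨rfl, rfl⟩
    · exact Or.inl ⟨a, mem_arrows.2 ⟨hs, hn⟩, rfl⟩
    · exact Or.inr ⟨a, mem_arrows.2 ⟨hn, hs⟩, rfl⟩
  calc N.card ≤ _ := Finset.card_le_card hsub
    _ ≤ _ := Finset.card_union_le _ _
    _ ≤ _ := add_le_add Finset.card_image_le Finset.card_image_le

section Subtrees

variable {m : ℕ} {x : Fin (m + 1) → V} {p : Fin m → Fin (m + 1)}

/-- The hypotheses on `x` and `p` say that `x` embeds a tree, in which `p i` is the parent of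
`i + 1`, into `G`. -/
theorem exists_injective_ends_eq (hx : Function.Injective x) (hp : ∀ i, p i < i.succ)
    (hadj : ∀ i, G.toSimpleGraph.Adj (x (p i)) (x i.succ)) :
    ∃ α : Fin m → E, Function.Injective α ∧
      ∀ i, s(G.src (α i), G.tgt (α i)) = s(x (p i), x i.succ) := by
  choose α hα using fun i => (adj_iff.1 (hadj i)).2
  refine ⟨α, fun i j hij => ?_, hα⟩
  have hends : s(x (p i), x i.succ) = s(x (p j), x j.succ) := by rw [← hα, ← hα, hij]
  rw [Sym2.eq_iff, hx.eq_iff, hx.eq_iff, hx.eq_iff, hx.eq_iff, Fin.succ_inj] at hends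
  rcases hends with ⟨-, h⟩ | ⟨hi, hj⟩
  · exact h
  · exact (lt_asymm (hi ▸ hp i) (hj ▸ hp j)).elim

theorem sum_parent_mul_lt_sum_sq [Fintype V] [Fintype E] (hq : G.titsForm.PosDef)
    (hx : Function.Injective x) (hp : ∀ i, p i < i.succ)
    (hadj : ∀ i, G.toSimpleGraph.Adj (x (p i)) (x i.succ)) {c : Fin (m + 1) → ℤ}
    (hc : ∀ i, 0 < c i) : ∑ i, c (p i) * c i.succ < ∑ i, c i ^ 2 := by
  obtain ⟨α, hα_inj, hα⟩ := exists_injective_ends_eq hx hp hadj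
  let z : V → ℤ := Function.extend x c 0
  have hz : ∀ i, z (x i) = c i := hx.extend_apply c 0
  have hz_zero : ∀ y ∉ Set.range x, z y = 0 := fun y hy => Function.extend_apply' c _ y hy
  have hz_nonneg : ∀ y, 0 ≤ z y := fun y => by
    by_cases hy : y ∈ Set.range x
    · obtain ⟨i, rfl⟩ := hy
      exact hz i ▸ (hc i).le
    · exact (hz_zero y hy).ge
  have hsq : ∑ i, c i ^ 2 = ∑ y, z y ^ 2 :=
    Fintype.sum_of_injective x hx _ _ (fun y hy => by rw [hz_zero y hy, sq, zero_mul])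
      fun i => by rw [hz]
  have hprod : ∑ i, c (p i) * c i.succ ≤ ∑ a, z (G.src a) * z (G.tgt a) := by
    calc ∑ i, c (p i) * c i.succ = ∑ i, z (G.src (α i)) * z (G.tgt (α i)) := by
          refine Finset.sum_congr rfl fun i _ => ?_
          rcases Sym2.eq_iff.1 (hα i) with ⟨hsrc, htgt⟩ | ⟨hsrc, htgt⟩
          · rw [hsrc, htgt, hz, hz]
          · rw [hsrc, htgt, hz, hz, mul_comm]
      _ = ∑ a ∈ Finset.univ.map ⟨α, hα_inj⟩, z (G.src a) * z (G.tgt a) := by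
          rw [Finset.sum_map, Function.Embedding.coeFn_mk]
      _ ≤ _ := Finset.sum_le_univ_sum_of_nonneg fun a => mul_nonneg (hz_nonneg _) (hz_nonneg _)
  have hpos := hq z fun h => (hc 0).ne' ((hz 0).symm.trans (congrFun h _))
  rw [titsForm_apply] at hpos
  linarith

end Subtrees

section PositiveDefinite

variable [Fintype V] [Fintype E]

theorem ends_injective (hq : G.titsForm.PosDef) :
    Function.Injective fun a => s(G.src a, G.tgt a) := by
  classical
  intro a b hab
  let S : Finset V := {G.src a, G.tgt a}
  have hcard : (G.arrows S S).card ≤ 1 :=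
    Nat.le_of_lt_succ ((card_arrows_lt_card hq ⟨G.src a, by simp [S]⟩).trans_le Finset.card_le_two)
  refine Finset.card_le_one.1 hcard a (mem_arrows.2 (by simp [S])) b (mem_arrows.2 ?_)
  rcases Sym2.eq_iff.1 hab with ⟨hsrc, htgt⟩ | ⟨hsrc, htgt⟩ <;> simp [S, hsrc, htgt]

theorem isObtainedFrom_of_adj_iff (hq : G.titsForm.PosDef) {W : Type*} {D : SimpleGraph W}
    (e : W ≃ V) (he : ∀ i j, G.toSimpleGraph.Adj (e i) (e j) ↔ D.Adj i j) :
    G.IsObtainedFrom D := by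
  have hadj : ∀ a, D.Adj (e.symm (G.src a)) (e.symm (G.tgt a)) := fun a => by
    rw [← he, e.apply_symm_apply, e.apply_symm_apply]
    exact adj_iff.2 ⟨src_ne_tgt hq a, a, rfl⟩
  let g : E → D.edgeSet := fun a => ⟨s(e.symm (G.src a), e.symm (G.tgt a)), hadj a⟩
  have hg : Function.Bijective g := by
    refine ⟨fun a b hab => ends_injective hq (Sym2.map.injective e.symm.injective ?_), ?_⟩
    · exact congrArg Subtype.val hab
    rintro ⟨p, hp⟩
    induction p with
    | _ i j =>
      obtain ⟨-, a, ha⟩ := adj_iff.1 ((he i j).2 hp)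
      have hmap := congrArg (Sym2.map e.symm) ha
      rw [Sym2.map_mk, Sym2.map_mk, e.symm_apply_apply, e.symm_apply_apply] at hmap
      exact ⟨a, Subtype.ext hmap⟩
  exact ⟨e.symm, Equiv.ofBijective g hg, fun _ => rfl⟩

section Indicator

variable [DecidableEq V]

theorem titsForm_indicator_insert_le (G : Biquiver V E) {S : Finset V} {y : V} (hy : y ∉ S) :
    G.titsForm (indicator (insert y S)) ≤
      G.titsForm (indicator S) + 1 - (G.arrows S {y}).card - (G.arrows {y} S).card := by
  rw [indicator_insert hy, ← eulerForm_self, map_add, map_add, LinearMap.add_apply,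
    LinearMap.add_apply, eulerForm_self, eulerForm_self, eulerForm_indicator, eulerForm_indicator]
  have hyy := titsForm_indicator_singleton_le G y
  simp only [Finset.inter_singleton_of_notMem hy, Finset.singleton_inter_of_notMem hy,
    Finset.card_empty]
  push_cast
  linarith

theorem titsForm_indicator_insert_le_one {S : Finset V} (hS : G.titsForm (indicator S) ≤ 1)
    {s y : V} (hs : s ∈ S) (hy : y ∉ S) (h : G.toSimpleGraph.Adj s y) :
    G.titsForm (indicator (insert y S)) ≤ 1 := by
  obtain ⟨-, a, ha⟩ := adj_iff.1 h
  have hle := titsForm_indicator_insert_le G hy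
  rcases mem_arrows_or_mem_arrows_of_ends_eq hs ha with ha | ha <;>
  · have hcard := Finset.card_pos.2 ⟨a, ha⟩
    lia

theorem eq_of_adj (hq : G.titsForm.PosDef) {S : Finset V} (hS : G.titsForm (indicator S) ≤ 1)
    {y : V} (hy : y ∉ S) {s t : V} (hs : s ∈ S) (ht : t ∈ S) (hsy : G.toSimpleGraph.Adj s y)
    (hty : G.toSimpleGraph.Adj t y) : s = t := by
  classical
  obtain ⟨-, a, ha⟩ := adj_iff.1 hsy
  obtain ⟨-, b, hb⟩ := adj_iff.1 hty
  have hpos := hq _ (indicator_ne_zero (Finset.insert_nonempty y S))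
  have hle := titsForm_indicator_insert_le G hy
  have hcard : (G.arrows S {y} ∪ G.arrows {y} S).card ≤ 1 :=
    (Finset.card_union_le _ _).trans (by lia)
  have hab : a = b := Finset.card_le_one.1 hcard
    a (Finset.mem_union.2 (mem_arrows_or_mem_arrows_of_ends_eq hs ha))
    b (Finset.mem_union.2 (mem_arrows_or_mem_arrows_of_ends_eq ht hb))
  exact Sym2.congr_left.1 (ha.symm.trans (hab ▸ hb))

theorem card_neighbors_le_three (hq : G.titsForm.PosDef) {T N : Finset V}
    (hT : G.titsForm (indicator T) ≤ 1) (hTN : Disjoint T N)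
    (hN : ∀ n ∈ N, ∃ s ∈ T, G.toSimpleGraph.Adj s n) : N.card ≤ 3 := by
  rcases N.eq_empty_or_nonempty with rfl | ⟨n, hn⟩
  · exact Nat.zero_le _
  have hcard := card_le_card_arrows_add_card_arrows hN
  have hpos := hq ((2 : ℤ) • indicator T + indicator N) fun h => by
    simpa [indicator, hn, Finset.disjoint_right.1 hTN hn] using congrFun h n
  have hNN : G.eulerForm (indicator N) (indicator N) ≤ N.card := by
    rw [eulerForm_indicator, Finset.inter_self]
    lia
  rw [← eulerForm_self] at hpos hT
  simp only [map_add, map_smul, LinearMap.add_apply, LinearMap.smul_apply, smul_eq_mul] at hpos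
  rw [eulerForm_indicator G T N, eulerForm_indicator G N T,
    Finset.disjoint_iff_inter_eq_empty.1 hTN, Finset.disjoint_iff_inter_eq_empty.1 hTN.symm,
    Finset.card_empty] at hpos
  lia

end Indicator

end PositiveDefinite

/-! ### Paths -/

/-- The vertices `x 0, …, x (m - 1)` form a path, whose length `m` counts vertices. The remaining
values of `x` are irrelevant. -/
structure IsPath (G : Biquiver V E) (m : ℕ) (x : ℕ → V) : Prop where
  inj : ∀ {i j}, i < m → j < m → x i = x j → i = j
  adj : ∀ {i}, i + 1 < m → G.toSimpleGraph.Adj (x i) (x (i + 1))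

namespace IsPath

variable {m : ℕ} {x : ℕ → V}

theorem reverse (h : G.IsPath m x) : G.IsPath m fun i => x (m - 1 - i) where
  inj hi hj hij := by
    have hij := h.inj (by lia) (by lia) hij
    lia
  adj {i} hi := by
    have hadj := h.adj (i := m - 1 - (i + 1)) (by lia)
    rw [show m - 1 - (i + 1) + 1 = m - 1 - i by lia] at hadj
    exact hadj.symm

theorem subpath (h : G.IsPath m x) {r s : ℕ} (hrs : s + r ≤ m) : G.IsPath r fun i => x (s + i) where
  inj hi hj hij := Nat.add_left_cancel (h.inj (by lia) (by lia) hij)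
  adj hi := h.adj (by lia)

theorem cons (h : G.IsPath m x) {w : V} (hw : ∀ i < m, x i ≠ w)
    (hadj : G.toSimpleGraph.Adj w (x 0)) : G.IsPath (m + 1) fun | 0 => w | i + 1 => x i where
  inj {i j} hi hj hij := by
    match i, j with
    | 0, 0 => rfl
    | 0, j + 1 => exact (hw j (by lia) hij.symm).elim
    | i + 1, 0 => exact (hw i (by lia) hij).elim
    | i + 1, j + 1 => exact congrArg _ (h.inj (by lia) (by lia) hij)
  adj {i} hi := by
    match i with
    | 0 => exact hadj
    | i + 1 => exact h.adj (by lia)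

theorem le_card [Fintype V] (h : G.IsPath m x) : m ≤ Fintype.card V := by
  simpa only [Fintype.card_fin] using Fintype.card_le_of_injective (fun i : Fin m => x i)
    fun i j hij => Fin.ext (h.inj i.2 j.2 hij)

theorem snoc_injective (h : G.IsPath m x) {v : V} (hv : ∀ i < m, x i ≠ v) :
    Function.Injective (Fin.snoc (fun i : Fin m => x i) v : Fin (m + 1) → V) :=
  Fin.snoc_injective_iff.2 ⟨fun i j hij => Fin.ext (h.inj i.2 j.2 hij),
    fun ⟨i, hi⟩ => hv i i.2 hi⟩

end IsPath

/-- The set of the vertices `x i` for `j ≤ i ≤ l`. -/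
def segment [DecidableEq V] (x : ℕ → V) (j l : ℕ) : Finset V := (Finset.Icc j l).image x

theorem mem_segment [DecidableEq V] {x : ℕ → V} {j l : ℕ} {y : V} :
    y ∈ segment x j l ↔ ∃ i, (j ≤ i ∧ i ≤ l) ∧ x i = y := by
  simp [segment]

theorem segment_succ [DecidableEq V] (x : ℕ → V) {j l : ℕ} (h : j ≤ l + 1) :
    segment x j (l + 1) = insert (x (l + 1)) (segment x j l) := by
  rw [segment, segment, ← Finset.image_insert, Finset.insert_Icc_right_eq_Icc_add_one h]

section Segments

variable [DecidableEq V] {m : ℕ} {x : ℕ → V}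

theorem IsPath.mem_segment_iff (h : G.IsPath m x) {i j l : ℕ} (hi : i < m) (hl : l < m) :
    x i ∈ segment x j l ↔ j ≤ i ∧ i ≤ l := by
  refine mem_segment.trans ⟨fun ⟨k, hk, hki⟩ => ?_, fun hi => ⟨i, hi, rfl⟩⟩
  exact h.inj (hk.2.trans_lt hl) hi hki ▸ hk

theorem notMem_segment {v : V} (hv : ∀ i < m, x i ≠ v) {j l : ℕ} (hl : l < m) :
    v ∉ segment x j l := fun hmem => by
  obtain ⟨i, hi, hiv⟩ := mem_segment.1 hmem
  exact hv i (hi.2.trans_lt hl) hiv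

variable [Fintype V] [Fintype E]

theorem IsPath.titsForm_segment_le_one (h : G.IsPath m x) {j l : ℕ} (hjl : j ≤ l) (hl : l < m) :
    G.titsForm (indicator (segment x j l)) ≤ 1 := by
  induction l, hjl using Nat.le_induction with
  | base =>
    rw [segment, Finset.Icc_self, Finset.image_singleton]
    exact titsForm_indicator_singleton_le G _
  | succ l hjl ih =>
    rw [segment_succ x (by lia)]
    refine titsForm_indicator_insert_le_one (ih (by lia)) ?_ ?_ (h.adj hl)
    · exact (h.mem_segment_iff (by lia) (by lia)).2 (by lia)
    · exact mt (h.mem_segment_iff hl (by lia)).1 (by lia)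

end Segments

section PathsPositiveDefinite

variable [Fintype V] [Fintype E] {m : ℕ} {x : ℕ → V}

theorem IsPath.adj_iff (hq : G.titsForm.PosDef) (h : G.IsPath m x) {i j : ℕ} (hi : i < m)
    (hj : j < m) : G.toSimpleGraph.Adj (x i) (x j) ↔ i + 1 = j ∨ j + 1 = i := by
  classical
  have hlt : ∀ i j, j < m → i < j → G.toSimpleGraph.Adj (x i) (x j) → i + 1 = j := by
    intro i j hj hij hadj
    obtain ⟨l, rfl⟩ := Nat.exists_eq_add_of_lt hij
    have heq := eq_of_adj hq (h.titsForm_segment_le_one (j := i) (l := i + l) (by lia) (by lia))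
      (mt (h.mem_segment_iff hj (by lia)).1 (by lia))
      ((h.mem_segment_iff (by lia) (by lia)).2 (by lia))
      ((h.mem_segment_iff (by lia) (by lia)).2 (by lia)) hadj (h.adj hj)
    exact congrArg Nat.succ (h.inj (by lia) (by lia) heq)
  constructor
  · intro hadj
    rcases lt_trichotomy i j with hij | rfl | hij
    · exact Or.inl (hlt i j hj hij hadj)
    · exact (hadj.ne rfl).elim
    · exact Or.inr (hlt j i hi hij hadj.symm)
  · rintro (rfl | rfl)
    · exact h.adj hj
    · exact (h.adj hi).symm

theorem IsPath.index_eq_of_adj (hq : G.titsForm.PosDef) (h : G.IsPath m x) {v : V}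
    (hv : ∀ i < m, x i ≠ v) {i j : ℕ} (hi : i < m) (hj : j < m)
    (hiv : G.toSimpleGraph.Adj (x i) v) (hjv : G.toSimpleGraph.Adj (x j) v) : i = j := by
  classical
  exact h.inj hi hj (eq_of_adj hq
    (h.titsForm_segment_le_one (Nat.zero_le (m - 1)) (by lia)) (notMem_segment hv (by lia))
    (mem_segment.2 ⟨i, by lia, rfl⟩) (mem_segment.2 ⟨j, by lia, rfl⟩) hiv hjv)

theorem IsPath.isObtainedFrom_pathGraph (hq : G.titsForm.PosDef) (h : G.IsPath m x)
    (hall : ∀ y, ∃ i < m, x i = y) : G.IsObtainedFrom (SimpleGraph.pathGraph m) := by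
  let e : Fin m ≃ V := Equiv.ofBijective (fun i => x i)
    ⟨fun i j hij => Fin.ext (h.inj i.2 j.2 hij), fun y => by
      obtain ⟨i, hi, rfl⟩ := hall y
      exact ⟨⟨i, hi⟩, rfl⟩⟩
  refine isObtainedFrom_of_adj_iff hq e fun i j => ?_
  rw [SimpleGraph.pathGraph_adj]
  exact h.adj_iff hq i.2 j.2

theorem IsPath.isObtainedFrom_branchGraph (hq : G.titsForm.PosDef) (h : G.IsPath m x) {k : ℕ}
    {v : V} (hv : ∀ i < m, x i ≠ v) (hk : k < m) (hadj : G.toSimpleGraph.Adj (x k) v)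
    (hall : ∀ y, (∃ i < m, x i = y) ∨ y = v) : G.IsObtainedFrom (branchGraph (m + 1) k) := by
  let f : Fin (m + 1) → V := Fin.snoc (fun i : Fin m => x i) v
  have hcast : ∀ i : Fin m, f i.castSucc = x i := Fin.snoc_castSucc _ _
  have hlast : f (Fin.last m) = v := Fin.snoc_last _ _
  have hsurj : Function.Surjective f := fun y => by
    rcases hall y with ⟨i, hi, rfl⟩ | rfl
    · exact ⟨Fin.castSucc ⟨i, hi⟩, hcast _⟩
    · exact ⟨Fin.last m, hlast⟩
  have hxv : ∀ i < m, G.toSimpleGraph.Adj (x i) v ↔ i = k := fun i hi =>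
    ⟨fun hiv => h.index_eq_of_adj hq hv hi hk hiv hadj, fun hik => hik ▸ hadj⟩
  refine isObtainedFrom_of_adj_iff hq (Equiv.ofBijective f ⟨h.snoc_injective hv, hsurj⟩)
    fun i j => ?_
  change G.toSimpleGraph.Adj (f i) (f j) ↔ _
  rw [branchGraph_adj, Ne, Fin.ext_iff]
  cases i using Fin.lastCases with
  | last =>
    cases j using Fin.lastCases with
    | last => simp
    | cast j =>
      rw [hcast, hlast, SimpleGraph.adj_comm, hxv j j.2, Fin.val_castSucc, Fin.val_last]
      lia
  | cast i =>
    cases j using Fin.lastCases with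
    | last =>
      rw [hcast, hlast, hxv i i.2, Fin.val_castSucc, Fin.val_last]
      lia
    | cast j =>
      rw [hcast, hcast, h.adj_iff hq i.2 j.2, Fin.val_castSucc, Fin.val_castSucc]
      lia

/-- Here and for `Ẽ₇` and `Ẽ₈` below, `c` spans the radical of the form of the extended Dynkin
diagram. -/
theorem IsPath.not_adj_of_extendedE6 (hq : G.titsForm.PosDef) (h : G.IsPath 5 x) {v w : V}
    (hv : ∀ i < 5, x i ≠ v) (hw : ∀ i < 5, x i ≠ w) (hxv : G.toSimpleGraph.Adj (x 2) v) :
    ¬ G.toSimpleGraph.Adj v w := fun hvw => by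
  have hlt := sum_parent_mul_lt_sum_sq hq (x := Fin.snoc (Fin.snoc (fun i : Fin 5 => x i) v) w)
    (p := ![0, 1, 2, 3, 2, 5]) (Fin.snoc_injective_iff.2 ⟨h.snoc_injective hv, ?_⟩) (by decide)
    (fun i => ?_) (c := ![1, 2, 3, 2, 1, 2, 1]) (by decide)
  · exact absurd hlt (by decide)
  · rintro ⟨i, hi⟩
    cases i using Fin.lastCases with
    | last => exact hvw.ne ((Fin.snoc_last _ _).symm.trans hi)
    | cast i => exact hw i i.2 ((Fin.snoc_castSucc _ _ i).symm.trans hi)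
  · fin_cases i
    exacts [h.adj (i := 0) (by lia), h.adj (i := 1) (by lia), h.adj (i := 2) (by lia),
      h.adj (i := 3) (by lia), hxv, hvw]

theorem IsPath.not_adj_of_extendedE7 (hq : G.titsForm.PosDef) (h : G.IsPath 7 x) {v : V}
    (hv : ∀ i < 7, x i ≠ v) : ¬ G.toSimpleGraph.Adj (x 3) v := fun hxv => by
  have hlt := sum_parent_mul_lt_sum_sq hq (x := Fin.snoc (fun i : Fin 7 => x i) v)
    (p := ![0, 1, 2, 3, 4, 5, 3]) (h.snoc_injective hv) (by decide) (fun i => ?_)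
    (c := ![1, 2, 3, 4, 3, 2, 1, 2]) (by decide)
  · exact absurd hlt (by decide)
  · fin_cases i
    exacts [h.adj (i := 0) (by lia), h.adj (i := 1) (by lia), h.adj (i := 2) (by lia),
      h.adj (i := 3) (by lia), h.adj (i := 4) (by lia), h.adj (i := 5) (by lia), hxv]

theorem IsPath.not_adj_of_extendedE8 (hq : G.titsForm.PosDef) (h : G.IsPath 8 x) {v : V}
    (hv : ∀ i < 8, x i ≠ v) : ¬ G.toSimpleGraph.Adj (x 2) v := fun hxv => by
  have hlt := sum_parent_mul_lt_sum_sq hq (x := Fin.snoc (fun i : Fin 8 => x i) v)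
    (p := ![0, 1, 2, 3, 4, 5, 6, 2]) (h.snoc_injective hv) (by decide) (fun i => ?_)
    (c := ![2, 4, 6, 5, 4, 3, 2, 1, 3]) (by decide)
  · exact absurd hlt (by decide)
  · fin_cases i
    exacts [h.adj (i := 0) (by lia), h.adj (i := 1) (by lia), h.adj (i := 2) (by lia),
      h.adj (i := 3) (by lia), h.adj (i := 4) (by lia), h.adj (i := 5) (by lia),
      h.adj (i := 6) (by lia), hxv]

end PathsPositiveDefinite

/-! ### Longest paths -/

/-- A path of maximal length. -/
structure IsLongestPath (G : Biquiver V E) (m : ℕ) (x : ℕ → V) : Prop extends G.IsPath m x where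
  length_le : ∀ {m' x'}, G.IsPath m' x' → m' ≤ m

theorem Connected.exists_isLongestPath [Finite V] (hG : G.Connected) :
    ∃ m x, G.IsLongestPath (m + 1) x := by
  have := Fintype.ofFinite V
  obtain ⟨y⟩ := hG.nonempty
  have hone : G.IsPath 1 fun _ => y := ⟨fun _ _ _ => by lia, fun _ => by lia⟩
  classical
  obtain ⟨x, hx⟩ := Nat.findGreatest_spec (P := fun m => ∃ x, G.IsPath m x) hone.le_card ⟨_, hone⟩
  have hmax : ∀ {m' x'}, G.IsPath m' x' → m' ≤ _ := fun h' =>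
    Nat.le_findGreatest (P := fun m => ∃ x, G.IsPath m x) h'.le_card ⟨_, h'⟩
  obtain ⟨m, hm⟩ := Nat.exists_eq_add_of_le' (hmax hone)
  rw [hm] at hx hmax
  exact ⟨m, x, hx, hmax⟩

namespace IsLongestPath

variable {m : ℕ} {x : ℕ → V}

theorem reverse (h : G.IsLongestPath m x) : G.IsLongestPath m fun i => x (m - 1 - i) where
  toIsPath := h.toIsPath.reverse
  length_le := h.length_le

theorem not_adj_zero (h : G.IsLongestPath m x) {v : V} (hv : ∀ i < m, x i ≠ v) :
    ¬ G.toSimpleGraph.Adj (x 0) v := fun hadj =>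
  (h.length_le (h.cons hv hadj.symm)).not_gt m.lt_succ_self

theorem index_pos_of_adj (h : G.IsLongestPath m x) {v : V} (hv : ∀ i < m, x i ≠ v) {k : ℕ}
    (hadj : G.toSimpleGraph.Adj (x k) v) : 0 < k :=
  Nat.pos_of_ne_zero fun hk => h.not_adj_zero hv (hk ▸ hadj)

theorem index_add_one_lt_of_adj (h : G.IsLongestPath m x) {v : V} (hv : ∀ i < m, x i ≠ v) {k : ℕ}
    (hk : k < m) (hadj : G.toSimpleGraph.Adj (x k) v) : k + 1 < m := by
  have hpos := h.reverse.index_pos_of_adj (v := v) (k := m - 1 - k) (fun i hi => hv _ (by lia))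
    (by rwa [show m - 1 - (m - 1 - k) = k by lia])
  lia

/-- Otherwise `w, v, x 1, …, x (m - 1)` would be a longer path. -/
theorem not_adj_of_adj_one (h : G.IsLongestPath (m + 1) x) {v w : V} (hv : ∀ i < m + 1, x i ≠ v)
    (hw : ∀ i < m + 1, x i ≠ w) (hadj : G.toSimpleGraph.Adj (x 1) v) :
    ¬ G.toSimpleGraph.Adj v w := fun hvw => by
  have htail : G.IsPath m fun i => x (1 + i) := h.subpath (by lia)
  have hv_tail := htail.cons (w := v) (fun i hi => hv _ (by lia)) hadj.symm
  refine (h.length_le (hv_tail.cons (w := w) (fun i hi => ?_) hvw.symm)).not_gt (by lia)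
  match i with
  | 0 => exact hvw.ne
  | i + 1 => exact hw _ (by lia)

variable [Fintype V] [Fintype E]

/-- Otherwise the segment from `x j` to `x k` would have four neighbours. -/
theorem eq_of_adj (h : G.IsLongestPath m x) (hq : G.titsForm.PosDef) {v w : V}
    (hv : ∀ i < m, x i ≠ v) (hw : ∀ i < m, x i ≠ w) {j k : ℕ} (hjk : j ≤ k) (hk : k < m)
    (hjv : G.toSimpleGraph.Adj (x j) v) (hkw : G.toSimpleGraph.Adj (x k) w) : v = w := by
  classical
  by_contra hvw
  have hj_pos := h.index_pos_of_adj hv hjv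
  have hk_lt := h.index_add_one_lt_of_adj hw hk hkw
  have hpath := h.toIsPath
  have hj_mem : x j ∈ segment x j k := mem_segment.2 ⟨j, by lia, rfl⟩
  have hk_mem : x k ∈ segment x j k := mem_segment.2 ⟨k, by lia, rfl⟩
  have hcard := card_neighbors_le_three hq (hpath.titsForm_segment_le_one hjk hk)
    (N := {x (j - 1), x (k + 1), v, w}) (by
      simp only [Finset.disjoint_insert_right, Finset.disjoint_singleton_right]
      exact ⟨mt (hpath.mem_segment_iff (by lia) hk).1 (by lia),
        mt (hpath.mem_segment_iff hk_lt hk).1 (by lia), notMem_segment hv hk, notMem_segment hw hk⟩)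
    (by
      simp only [Finset.forall_mem_insert, Finset.mem_singleton, forall_eq]
      exact ⟨⟨_, hj_mem, (hpath.adj_iff hq (by lia) (by lia)).2 (by lia)⟩,
        ⟨_, hk_mem, hpath.adj hk_lt⟩, ⟨_, hj_mem, hjv⟩, ⟨_, hk_mem, hkw⟩⟩)
  have hne : x (j - 1) ≠ x (k + 1) := fun heq => by
    have := hpath.inj (by lia) hk_lt heq
    lia
  rw [Finset.card_insert_of_notMem (by
      simp only [Finset.mem_insert, Finset.mem_singleton, not_or]
      exact ⟨hne, hv _ (by lia), hw _ (by lia)⟩),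
    Finset.card_insert_of_notMem (by
      simp only [Finset.mem_insert, Finset.mem_singleton, not_or]
      exact ⟨hv _ hk_lt, hw _ hk_lt⟩), Finset.card_pair hvw] at hcard
  lia

theorem not_adj_of_adj (h : G.IsLongestPath m x) (hq : G.titsForm.PosDef) {v w : V}
    (hv : ∀ i < m, x i ≠ v) (hw : ∀ i < m, x i ≠ w) {k : ℕ} (hk : k < m)
    (hkv : G.toSimpleGraph.Adj (x k) v) : ¬ G.toSimpleGraph.Adj v w := by
  have hk_pos := h.index_pos_of_adj hv hkv
  have hk_lt := h.index_add_one_lt_of_adj hv hk hkv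
  obtain ⟨m, rfl⟩ := Nat.exists_eq_add_of_lt hk
  rcases (by lia : k = 1 ∨ m = 1 ∨ 2 ≤ k ∧ 2 ≤ m) with rfl | rfl | ⟨hk_two, hm⟩
  · exact h.not_adj_of_adj_one hv hw hkv
  · exact h.reverse.not_adj_of_adj_one (fun i _ => hv _ (by lia)) (fun i _ => hw _ (by lia)) hkv
  · refine (h.subpath (r := 5) (s := k - 2) (by lia)).not_adj_of_extendedE6 hq
      (fun i hi => hv _ (by lia)) (fun i hi => hw _ (by lia)) ?_
    rwa [Nat.sub_add_cancel hk_two]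

theorem forall_eq_or_eq (h : G.IsLongestPath m x) (hG : G.Connected) (hq : G.titsForm.PosDef)
    {v : V} (hv : ∀ i < m, x i ≠ v) {k : ℕ} (hk : k < m) (hkv : G.toSimpleGraph.Adj (x k) v)
    (y : V) : (∃ i < m, x i = y) ∨ y = v := by
  by_contra hy
  obtain ⟨s, hs, w, hw, hsw⟩ := hG.exists_adj (S := {y | (∃ i < m, x i = y) ∨ y = v})
    ⟨v, Or.inr rfl⟩ hy
  obtain ⟨hw_path, hwv⟩ := not_or.1 hw
  have hw_path : ∀ i < m, x i ≠ w := fun i hi hiw => hw_path ⟨i, hi, hiw⟩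
  rcases hs with ⟨j, hj, rfl⟩ | rfl
  · rcases le_total j k with hjk | hkj
    · exact hwv (h.eq_of_adj hq hw_path hv hjk hk hsw hkv)
    · exact hwv (h.eq_of_adj hq hv hw_path hkj hj hkv hsw).symm
  · exact h.not_adj_of_adj hq hv hw_path hk hkv hsw

theorem isDynkin_of_adj (h : G.IsLongestPath m x) (hG : G.Connected) (hq : G.titsForm.PosDef)
    {v : V} (hv : ∀ i < m, x i ≠ v) {k : ℕ} (hkm : 2 * k < m)
    (hkv : G.toSimpleGraph.Adj (x k) v) : G.IsDynkin := by
  have hk_pos := h.index_pos_of_adj hv hkv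
  have hall := h.forall_eq_or_eq hG hq hv (by lia) hkv
  rcases (by lia : k = 1 ∨ k = 2 ∨ 3 ≤ k) with rfl | rfl | hk
  · have hv_rev : ∀ i < m, x (m - 1 - i) ≠ v := fun i _ => hv _ (by lia)
    have hkv_rev : G.toSimpleGraph.Adj (x (m - 1 - (m - 2))) v := by
      rwa [show m - 1 - (m - 2) = 1 by lia]
    exact Or.inr <| Or.inl ⟨m + 1, by lia, h.reverse.isObtainedFrom_branchGraph hq hv_rev (by lia)
      hkv_rev (h.reverse.forall_eq_or_eq hG hq hv_rev (by lia) hkv_rev)⟩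
  · have hm : m < 8 := by
      by_contra! hm
      exact (h.subpath (r := 8) (s := 0) (by lia)).not_adj_of_extendedE8 hq
        (fun i hi => hv _ (by lia)) hkv
    have hbranch := h.isObtainedFrom_branchGraph hq hv (by lia) hkv hall
    rcases (by lia : m = 5 ∨ m = 6 ∨ m = 7) with rfl | rfl | rfl
    · exact Or.inr (Or.inr (Or.inl hbranch))
    · exact Or.inr (Or.inr (Or.inr (Or.inl hbranch)))
    · exact Or.inr (Or.inr (Or.inr (Or.inr hbranch)))
  · refine ((h.subpath (r := 7) (s := k - 3) (by lia)).not_adj_of_extendedE7 hq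
      (fun i hi => hv _ (by lia)) ?_).elim
    rwa [Nat.sub_add_cancel hk]

end IsLongestPath

theorem isDynkin_of_posDef [Fintype V] [Fintype E] (hG : G.Connected) (hq : G.titsForm.PosDef) :
    G.IsDynkin := by
  obtain ⟨m, x, h⟩ := hG.exists_isLongestPath
  by_cases hall : ∀ y, ∃ i < m + 1, x i = y
  · exact Or.inl ⟨m + 1, by lia, h.isObtainedFrom_pathGraph hq hall⟩
  obtain ⟨y, hy⟩ := not_forall.1 hall
  obtain ⟨_, ⟨k, hk, rfl⟩, v, hv, hkv⟩ := hG.exists_adj (S := {y | ∃ i < m + 1, x i = y})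
    ⟨x 0, 0, by lia, rfl⟩ hy
  have hv : ∀ i < m + 1, x i ≠ v := fun i hi hiv => hv ⟨i, hi, hiv⟩
  rcases lt_or_ge (2 * k) (m + 1) with hkm | hkm
  · exact h.isDynkin_of_adj hG hq hv hkm hkv
  · refine h.reverse.isDynkin_of_adj hG hq (v := v) (k := m - k) (fun i _ => hv _ (by lia))
      (by lia) ?_
    rwa [show m + 1 - 1 - (m - k) = k by lia]

end Biquiver

theorem theorem1_general {V : Type*} {E : Type*} [Fintype V] [Fintype E] (G : Biquiver V E) :
    ((G.IsDynkin ↔ G.Connected ∧ G.RepresentationFinite) ∧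
      (G.RepresentationFinite ↔ G.titsForm.PosDef)) ∧
    (G.RepresentationFinite → ∀ z : V → ℕ,
      ((∃ A : G.Representation, A.Indecomposable ∧ A.dim = z) ↔
        G.titsForm (fun x => (z x : ℤ)) = 1) ∧
      (∀ A B : G.Representation, A.Indecomposable → B.Indecomposable →
        A.dim = z → B.dim = z → A.Isomorphic B)) := by
  have hfinite : G.RepresentationFinite ↔ G.titsForm.PosDef :=
    ⟨fun h => h.posDef, Biquiver.representationFinite_of_posDef⟩
  have hdynkin : G.IsDynkin ↔ G.Connected ∧ G.titsForm.PosDef :=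
    ⟨fun h => ⟨h.connected, h.posDef⟩, fun h => Biquiver.isDynkin_of_posDef h.1 h.2⟩
  refine ⟨⟨by rw [hdynkin, hfinite], hfinite⟩, fun hrep z => ?_⟩
  have hq := hfinite.1 hrep
  refine ⟨⟨?_, Biquiver.Representation.exists_indecomposable_of_titsForm_eq_one hq⟩, ?_⟩
  · rintro ⟨A, hA, rfl⟩
    exact (hA.isBrick hq).titsForm_dimVector hq
  · rintro A B hA hB rfl hdim
    exact (hA.isBrick hq).isomorphic_of_dim_eq hq (hB.isBrick hq) hdim.symm

theorem theorem1 {V : Type*} {E : Type*} [Fintype V] [Fintype E] (G : Biquiver V E)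
    (hG : G.Connected) :
    ((G.RepresentationFinite ↔ G.IsDynkin) ∧
      (G.RepresentationFinite ↔ G.titsForm.PosDef)) ∧
    (G.RepresentationFinite → ∀ z : V → ℕ,
      ((∃ A : G.Representation, A.Indecomposable ∧ A.dim = z) ↔
        G.titsForm (fun x => (z x : ℤ)) = 1) ∧
      (∀ A B : G.Representation, A.Indecomposable → B.Indecomposable →
        A.dim = z → B.dim = z → A.Isomorphic B)) := by
  obtain ⟨⟨hdynkin, hfinite⟩, hroots⟩ := theorem1_general G
  exact ⟨⟨⟨fun h => hdynkin.2 ⟨hG, h⟩, fun h => (hdynkin.1 h).2⟩, hfinite⟩, hroots⟩
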